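/- Setting. Let $N_L\ge 1$, let $\mathbf x=(\mathbf X_1,\dots,\mathbf X_{N_L})\in\mathbb R^d$ collect weight matrices $\mathbf X_\ell\in\mathbb R^{m_\ell\times n_\ell}$, $d=\sum_\ell m_\ell n_\ell$, and let $1\le k_\ell\le m_\ell n_\ell$. Put $\underline\delta=\min_\ell \frac{k_\ell}{m_\ell n_\ell}$. Assume that $f:\mathbb R^d\to\mathbb R$ is bounded below and differentiable with $\|\nabla f(\mathbf x)-\nabla f(\mathbf y)\|_2\le L\|\mathbf x-\mathbf y\|_2$ for all $\mathbf x,\mathbf y$, where $L>0$, and that the stochastic gradient oracle $(F,\mathcal D)$ satisfies, for every $\mathbf x$ and $\ell$, $\mathbb E_{\xi\sim\mathcal D}[\nabla_\ell F(\mathbf x;\xi)]=\nabla_\ell f(\mathbf x)$ and $\mathbb E_{\xi\sim\mathcal D}\|\nabla_\ell F(\mathbf x;\xi)-\nabla_\ell f(\mathbf x)\|_F^2\le\sigma_\ell^2$ with $\sigma_\ell>0$ (where $\nabla_\ell$ is the gradient with respect to $\mathbf X_\ell$, and $(\mathbf x,\xi)\mapsto\nabla F(\mathbf x;\xi)$ is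 measurable). Put $\sigma=\sqrt{\sum_\ell\sigma_\ell^2}$ and $\Delta=f(\mathbf x^{(0)})-\inf_{\mathbf x} f(\mathbf x)$. Algorithm (large-batch GaSare with MSGD; parameters $\beta_1,\eta\in\mathbb R$ and $\tau,\mathcal B\in\mathbb N_{\ge1}$). Start from a deterministic $\mathbf x^{(0)}$ and $\mathbf M_\ell^{(-1)}=0$. All samples $\xi$ below are i.i.d. from $\mathcal D$. For $t=0,1,2,\dots$ and every $\ell$: if $\tau\mid t$, set $\mathbf G_\ell^{(t)}=\frac1{\mathcal B}\sum_{b=1}^{\mathcal B}\nabla_\ell F(\mathbf x^{(t)};\xi^{(t,b)})$ and $\mathbf S_\ell^{(t)}=\mathrm{Top}_{k_\ell}(\mathbf G_\ell^{(t)})$, the $0/1$ mask with exactly $k_\ell$ ones, placed at entries of $\mathbf G_\ell^{(t)}$ with the $k_\ell$ largest absolute values (ties are broken by an arbitrary fixed measurable rule); otherwise, set $\mathbf G_\ell^{(t)}=\nabla_\ell F(\mathbf x^{(t)};\xi^{(t)})$ and $\mathbf S_\ell^{(t)}=\mathbf S_\ell^{(t-1)}$. Then, with $\odot$ the entrywise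 product, $$\mathbf M_\ell^{(t)}=(1-\beta_1)\,\mathbf S_\ell^{(t)}\odot\mathbf M_\ell^{(t-1)}+\beta_1\,\mathbf S_\ell^{(t)}\odot\mathbf G_\ell^{(t)},\qquad \mathbf X_\ell^{(t+1)}=\mathbf X_\ell^{(t)}-\eta\,\mathbf S_\ell^{(t)}\odot\mathbf M_\ell^{(t)}.$$ Theorem (convergence of large-batch GaSare). (1) If $0<\beta_1\le1$, $\tau\ge\frac{64}{3\beta_1\underline\delta}$, $\mathcal B\ge1$ and $0<\eta\le\min\Big\{\frac1{4L},\sqrt{\frac{3\underline\delta\beta_1^2}{80L^2}},\sqrt{\frac{\underline\delta}{40\tau^2L^2}},\sqrt{\frac{3\beta_1}{32\tau L^2}}\Big\}$, then for every $K\ge1$ $$\frac1{K\tau}\sum_{t=0}^{K\tau-1}\mathbb E\|\nabla f(\mathbf x^{(t)})\|_2^2\le\frac{16\Delta}{\underline\delta\,\eta K\tau}+\Big(\frac{160}{3\beta_1\underline\delta\tau\mathcal B}+\frac{352}{3\underline\delta^2\mathcal B}+\frac{32\beta_1}{3\underline\delta}\Big)\sigma^2 .$$ (2) Let $\Delta>0$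 and let $T$ be an integer with $T\ge2+\frac{128}{3\underline\delta}+\frac{(128\sigma)^2}{9\sqrt{\underline\delta}L\Delta}$. With $$\beta_1=\Big(1+\sqrt{\tfrac{\underline\delta^{3/2}\sigma^2T}{L\Delta}}\Big)^{-1},\quad \tau=\Big\lceil\tfrac{64}{3\underline\delta\beta_1}\Big\rceil,\quad \eta=\Big(4L+\sqrt{\tfrac{80L^2}{3\underline\delta\beta_1^2}}+\sqrt{\tfrac{40\tau^2L^2}{\underline\delta}}+\sqrt{\tfrac{32\tau L^2}{3\beta_1}}\Big)^{-1},\quad \mathcal B=\Big\lceil\tfrac1{\underline\delta\beta_1}\Big\rceil,$$ one has $$\frac1T\sum_{t=0}^{T-1}\mathbb E\|\nabla f(\mathbf x^{(t)})\|_2^2\le C\left(\frac{L\Delta}{\underline\delta^{5/2}T}+\sqrt{\frac{L\Delta\sigma^2}{\underline\delta^{7/2}T}}\right).$$ (3) Consequently, if $\Delta>0$, then for every $\varepsilon>0$ there is a number of iterations $T$, admissible in (2), such that with the parameters of (2) one has $\frac1T\sum_{t=0}^{T-1}\mathbb E\|\nabla f(\mathbf x^{(t)})\|_2^2\le\varepsilon$,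 while the total number of stochastic gradients $\nabla F(\mathbf x;\xi)$ computed in these $T$ iterations ($\mathcal B$ of them at each iteration $t$ with $\tau\mid t$ and one at each other iteration) is at most $$C\left(\frac{L\Delta\sigma^2}{\underline\delta^{7/2}\varepsilon^2}+\frac{L\Delta}{\underline\delta^{5/2}\varepsilon}+\frac{\sigma^2}{\underline\delta^{1/2}L\Delta}+\frac1{\underline\delta}\right).$$ Here $C>0$ is an absolute constant, and all the expectations above are finite. -/

import Mathlib

open MeasureTheory ProbabilityTheory
open scoped Matrix

universe u v

namespace GaSare

noncomputable section

/-- The parameter space `ℝ^d`, `d = ∑ ℓ, m ℓ * n ℓ`, with the Euclidean norm; the coordinate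
`⟨ℓ, i, j⟩` is the `(i, j)` entry of the `ℓ`-th weight matrix. -/
abbrev Params {N : ℕ} (m n : Fin N → ℕ) : Type :=
  EuclideanSpace ℝ (Σ ℓ : Fin N, Fin (m ℓ) × Fin (n ℓ))

/-- A family of matrices, the `ℓ`-th one of size `m ℓ × n ℓ`. -/
abbrev Blocks {N : ℕ} (m n : Fin N → ℕ) : Type :=
  (ℓ : Fin N) → Matrix (Fin (m ℓ)) (Fin (n ℓ)) ℝ

/-- The weight matrices collected in a parameter vector. -/
def blocks {N : ℕ} {m n : Fin N → ℕ} (x : Params m n) : Blocks m n :=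
  fun ℓ => Matrix.of fun i j => x ⟨ℓ, (i, j)⟩

/-- The parameter vector that collects given weight matrices (inverse of `blocks`). -/
def assemble {N : ℕ} {m n : Fin N → ℕ} (X : Blocks m n) : Params m n :=
  WithLp.toLp 2 fun p => X p.1 p.2.1 p.2.2

/-- Squared Frobenius norm. -/
def frobSq {a b : ℕ} (A : Matrix (Fin a) (Fin b) ℝ) : ℝ := ∑ i, ∑ j, A i j ^ 2

/-- `S ∈ {0,1}^{a × b}` has exactly `k` ones. -/
def IsSparseMask {a b : ℕ} (k : ℕ) (S : Matrix (Fin a) (Fin b) ℝ) : Prop :=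
  (∀ i j, S i j = 0 ∨ S i j = 1) ∧ frobSq S = k

/-- `S` is a mask with `k` ones, placed at entries of `G` with the `k` largest absolute values. -/
def IsTopKMask {a b : ℕ} (k : ℕ) (G S : Matrix (Fin a) (Fin b) ℝ) : Prop :=
  IsSparseMask k S ∧ ∀ i j i' j', S i j = 1 → S i' j' = 0 → |G i' j'| ≤ |G i j|

/-- `topk` is a Top-`k` rule: it assigns to every matrix a Top-`k` mask of it
(ties are broken in an arbitrary measurable way). -/
def IsTopKRule {a b : ℕ} (k : ℕ)
    (topk : Matrix (Fin a) (Fin b) ℝ → Matrix (Fin a) (Fin b) ℝ) : Prop :=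
  Measurable (fun (g : Fin a → Fin b → ℝ) i j => topk (Matrix.of g) i j) ∧
    ∀ G, IsTopKMask k G (topk G)

/-- `f` is differentiable and its gradient is `L`-Lipschitz. -/
def IsSmooth {N : ℕ} {m n : Fin N → ℕ} (L : ℝ) (f : Params m n → ℝ) : Prop :=
  Differentiable ℝ f ∧ ∀ x y, ‖gradient f x - gradient f y‖ ≤ L * ‖x - y‖

/-- The stochastic gradient `∇F(x; ξ)` with respect to `x`. -/
def stochGrad {N : ℕ} {m n : Fin N → ℕ} {Ξ : Type u} (F : Params m n → Ξ → ℝ)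
    (x : Params m n) (ξ : Ξ) : Params m n :=
  gradient (fun y => F y ξ) x

/-- The gradient oracle `(F, 𝒟)` is unbiased for `∇f` and its `ℓ`-th block has variance
at most `(σ ℓ)²`. -/
structure IsGradientOracle {N : ℕ} {m n : Fin N → ℕ} {Ξ : Type u} [MeasurableSpace Ξ]
    (f : Params m n → ℝ) (F : Params m n → Ξ → ℝ) (𝒟 : Measure Ξ) (σ : Fin N → ℝ) : Prop where
  differentiable : ∀ x, ∀ᵐ ξ ∂𝒟, DifferentiableAt ℝ (fun y => F y ξ) x
  measurable : Measurable fun p : Params m n × Ξ => stochGrad F p.1 p.2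
  integrable : ∀ x ℓ i j, Integrable (fun ξ => blocks (stochGrad F x ξ) ℓ i j) 𝒟
  unbiased : ∀ x ℓ i j,
    ∫ ξ, blocks (stochGrad F x ξ) ℓ i j ∂𝒟 = blocks (gradient f x) ℓ i j
  integrable_sq : ∀ x ℓ, Integrable
    (fun ξ => frobSq (blocks (stochGrad F x ξ) ℓ - blocks (gradient f x) ℓ)) 𝒟
  variance_le : ∀ x ℓ,
    ∫ ξ, frobSq (blocks (stochGrad F x ξ) ℓ - blocks (gradient f x) ℓ) ∂𝒟 ≤ σ ℓ ^ 2

/-- The samples `ξ t b` (`b`-th sample of iteration `t`) are i.i.d. with law `𝒟`. -/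
structure IsSampleStream {Ω : Type v} [MeasurableSpace Ω] {Ξ : Type u} [MeasurableSpace Ξ]
    (μ : Measure Ω) (𝒟 : Measure Ξ) (ξ : ℕ → ℕ → Ω → Ξ) : Prop where
  measurable : ∀ t b, Measurable (ξ t b)
  law : ∀ t b, μ.map (ξ t b) = 𝒟
  indep : iIndepFun (fun p : ℕ × ℕ => ξ p.1 p.2) μ

/-- State before iteration `t`: iterate `x^{(t)}`, masks `S^{(t-1)}`, momenta `M^{(t-1)}`. -/
structure State {N : ℕ} (m n : Fin N → ℕ) : Type where
  x : Params m n
  S : Blocks m n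
  M : Blocks m n

/-- The gradient estimate `G^{(t)}`: average over a batch of `B` samples if `τ ∣ t`,
a single-sample stochastic gradient otherwise. -/
def gradEst {N : ℕ} {m n : Fin N → ℕ} {Ξ : Type u} (F : Params m n → Ξ → ℝ) (τ B t : ℕ)
    (ξ : ℕ → Ξ) (x : Params m n) : Blocks m n :=
  fun ℓ =>
    if τ ∣ t then (1 / (B : ℝ)) • ∑ b ∈ Finset.range B, blocks (stochGrad F x (ξ b)) ℓ
    else blocks (stochGrad F x (ξ 0)) ℓ

/-- Iteration `t` of large-batch GaSare with MSGD. -/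
def step {N : ℕ} {m n : Fin N → ℕ} {Ξ : Type u} (F : Params m n → Ξ → ℝ)
    (topk : (ℓ : Fin N) → Matrix (Fin (m ℓ)) (Fin (n ℓ)) ℝ → Matrix (Fin (m ℓ)) (Fin (n ℓ)) ℝ)
    (β η : ℝ) (τ B t : ℕ) (ξ : ℕ → Ξ) (s : State m n) : State m n :=
  let G : Blocks m n := gradEst F τ B t ξ s.x
  let S : Blocks m n := fun ℓ => if τ ∣ t then topk ℓ (G ℓ) else s.S ℓ
  let R : Blocks m n := fun ℓ => S ℓ ⊙ G ℓ
  let M : Blocks m n := fun ℓ => (1 - β) • (S ℓ ⊙ s.M ℓ) + β • R ℓ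
  { x := assemble fun ℓ => blocks s.x ℓ - η • (S ℓ ⊙ M ℓ)
    S := S
    M := M }

/-- The run started at `x₀` with zero momentum, driven by the samples `ξ t b`; the initial mask
is irrelevant, since a new mask is computed at `t = 0`. -/
def run {N : ℕ} {m n : Fin N → ℕ} {Ξ : Type u} (F : Params m n → Ξ → ℝ)
    (topk : (ℓ : Fin N) → Matrix (Fin (m ℓ)) (Fin (n ℓ)) ℝ → Matrix (Fin (m ℓ)) (Fin (n ℓ)) ℝ)
    (β η : ℝ) (τ B : ℕ) (x₀ : Params m n) (ξ : ℕ → ℕ → Ξ) : ℕ → State m n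
  | 0 => { x := x₀, S := 0, M := 0 }
  | t + 1 => step F topk β η τ B t (ξ t) (run F topk β η τ B x₀ ξ t)

/-- The random iterate `x^{(t)}`. -/
def iterate {N : ℕ} {m n : Fin N → ℕ} {Ω : Type v} {Ξ : Type u} (F : Params m n → Ξ → ℝ)
    (topk : (ℓ : Fin N) → Matrix (Fin (m ℓ)) (Fin (n ℓ)) ℝ → Matrix (Fin (m ℓ)) (Fin (n ℓ)) ℝ)
    (β η : ℝ) (τ B : ℕ) (x₀ : Params m n) (ξ : ℕ → ℕ → Ω → Ξ) (t : ℕ) (ω : Ω) : Params m n :=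
  (run F topk β η τ B x₀ (fun s b => ξ s b ω) t).x

/-- The expectations `𝔼‖∇f(x^{(t)})‖²`, `t < T`, are finite and their average is at most `c`. -/
def AvgSqGradLE {N : ℕ} {m n : Fin N → ℕ} {Ω : Type v} [MeasurableSpace Ω] (μ : Measure Ω)
    (f : Params m n → ℝ) (x : ℕ → Ω → Params m n) (T : ℕ) (c : ℝ) : Prop :=
  (∀ t < T, Integrable (fun ω => ‖gradient f (x t ω)‖ ^ 2) μ) ∧
    (1 / (T : ℝ)) * ∑ t ∈ Finset.range T, ∫ ω, ‖gradient f (x t ω)‖ ^ 2 ∂μ ≤ c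

/-- `δ̲ = min_ℓ k ℓ / (m ℓ * n ℓ)`. -/
def minDensity {N : ℕ} (m n k : Fin N → ℕ) : ℝ := ⨅ ℓ, (k ℓ : ℝ) / ((m ℓ : ℝ) * (n ℓ : ℝ))

/-- `σ = √(∑ ℓ, (σ ℓ)²)`. -/
def totalSigma {N : ℕ} (σ : Fin N → ℝ) : ℝ := √(∑ ℓ, σ ℓ ^ 2)

/-- `Δ = f(x₀) - inf f`. -/
def gap {N : ℕ} {m n : Fin N → ℕ} (f : Params m n → ℝ) (x₀ : Params m n) : ℝ := f x₀ - ⨅ x, f x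

/-- Momentum parameter for `T` iterations. -/
def betaChoice (L Δ σ δ : ℝ) (T : ℕ) : ℝ := (1 + √(δ ^ (3 / 2 : ℝ) * σ ^ 2 * T / (L * Δ)))⁻¹

/-- Mask changing period. -/
def tauChoice (δ β : ℝ) : ℕ := ⌈64 / (3 * δ * β)⌉₊

/-- Learning rate. -/
def etaChoice (L δ β : ℝ) (τ : ℕ) : ℝ :=
  (4 * L + √(80 * L ^ 2 / (3 * δ * β ^ 2)) + √(40 * (τ : ℝ) ^ 2 * L ^ 2 / δ)
    + √(32 * (τ : ℝ) * L ^ 2 / (3 * β)))⁻¹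

/-- Large batch size. -/
def batchChoice (δ β : ℝ) : ℕ := ⌈1 / (δ * β)⌉₊

/-- Smallest admissible number of iterations. -/
def minIterations (L Δ σ δ : ℝ) : ℝ :=
  2 + 128 / (3 * δ) + (128 * σ) ^ 2 / (9 * √δ * L * Δ)

/-- The number of stochastic gradients `∇F(x; ξ)` computed in `T` iterations. -/
def gradientEvals (τ B T : ℕ) : ℕ := ∑ t ∈ Finset.range T, if τ ∣ t then B else 1

end

end GaSare

namespace GaSare

noncomputable section

/-! Write g_t for the gradient of `f` at x_t. A masked step decreases `f` through the retained part
S_t ⊙ g_t only, at the price of the tracking error ‖M_t - S_t ⊙ g_t‖² and with a gain proportional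
to ‖x_{t+1} - x_t‖² (`descent_of_maskMul`). So the retained part has to control the whole gradient,
and the tracking error has to be summable against these gains.

Retention. A Top-k mask keeps at least a δ-fraction of the squared norm of the matrix it is computed
from (`IsTopKMask.density_le`). That matrix is a noisy batch gradient, so g_t itself is retained up
to the batch variance σ²/B (`IsMask.retained_le`); a large batch makes this loss small. Within a
period the mask is frozen, and the gradient moves by at most L times the drift of the iterates,
which a small η absorbs.

Tracking. The mean squared error contracts by 1 - β/2 per iteration. If the mask is kept, the fresh
noise is orthogonal to the past, mask included, and costs only β²σ² (`IsMask.momentum_error_keep`).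
If the mask is recomputed it depends on the noise, so convexity replaces orthogonality, and the
change costs ‖g_t‖² plus β times the batch variance (`IsMask.momentum_error_change`). This extra
‖g_t‖² occurs once per period and is multiplied by 2/β after summation; the τ iterations of the
period on which δ‖g_t‖² is retained pay for it as soon as τ ≥ 64/(3βδ).

`sum_le_of_recursions` combines these inequalities, which gives the general bound. For the rate, β
balances the Δ-term against the noise, and T is rounded up to whole periods at the cost of a factor
2. For the complexity, B ≤ τ ≤ T, so T iterations use O(T) stochastic gradients. -/

/-- `S` has entries in `{0, 1}`. -/
def IsMask {ι : Type*} [Fintype ι] (S : EuclideanSpace ℝ ι) : Prop := ∀ i, S i = 0 ∨ S i = 1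

/-- Entrywise multiplication by `S`. -/
def maskMul {ι : Type*} [Fintype ι] (S : EuclideanSpace ℝ ι) :
    EuclideanSpace ℝ ι →ₗ[ℝ] EuclideanSpace ℝ ι where
  toFun v := WithLp.toLp 2 fun i => S i * v i
  map_add' v w := by ext i; simp [mul_add]
  map_smul' c v := by ext i; simp; ring

/-! ### Pointwise inequalities for masked vectors and masked momentum. -/

section Mask

variable {ι : Type*} [Fintype ι] {S : EuclideanSpace ℝ ι}

@[simp] lemma maskMul_apply (S v : EuclideanSpace ℝ ι) (i : ι) : maskMul S v i = S i * v i := rfl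

lemma IsMask.maskMul_maskMul (hS : IsMask S) (v : EuclideanSpace ℝ ι) :
    maskMul S (maskMul S v) = maskMul S v := by
  ext i
  rcases hS i with h | h <;> simp [h]

lemma inner_maskMul_right (v w : EuclideanSpace ℝ ι) :
    inner ℝ v (maskMul S w) = inner ℝ (maskMul S v) w := by
  simp only [PiLp.inner_apply, maskMul_apply, RCLike.inner_apply, conj_trivial]
  exact Finset.sum_congr rfl fun i _ => by ring

lemma norm_sq_add_eq (v w : EuclideanSpace ℝ ι) :
    ‖v + w‖ ^ 2 = ‖v‖ ^ 2 + 2 * inner ℝ v w + ‖w‖ ^ 2 := norm_add_sq_real v w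

lemma IsMask.norm_sq_eq (hS : IsMask S) (v : EuclideanSpace ℝ ι) :
    ‖v‖ ^ 2 = ‖maskMul S v‖ ^ 2 + ‖v - maskMul S v‖ ^ 2 := by
  simp only [EuclideanSpace.real_norm_sq_eq, ← Finset.sum_add_distrib]
  refine Finset.sum_congr rfl fun i _ => ?_
  rcases hS i with h | h <;> simp [h]

lemma IsMask.norm_maskMul_sq_le (hS : IsMask S) (v : EuclideanSpace ℝ ι) :
    ‖maskMul S v‖ ^ 2 ≤ ‖v‖ ^ 2 := by
  rw [hS.norm_sq_eq v]; nlinarith [sq_nonneg ‖v - maskMul S v‖]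

lemma IsMask.norm_maskMul_le (hS : IsMask S) (v : EuclideanSpace ℝ ι) : ‖maskMul S v‖ ≤ ‖v‖ :=
  (sq_le_sq₀ (norm_nonneg _) (norm_nonneg _)).1 (hS.norm_maskMul_sq_le v)

lemma norm_add_sq_le_weighted {E : Type*} [SeminormedAddCommGroup E] (v w : E) {c : ℝ}
    (hc : 0 < c) : ‖v + w‖ ^ 2 ≤ (1 + c) * ‖v‖ ^ 2 + (1 + 1 / c) * ‖w‖ ^ 2 := by
  have h1 : ‖v + w‖ ^ 2 ≤ (‖v‖ + ‖w‖) ^ 2 := by gcongr; exact norm_add_le v w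
  have h2 : 2 * (‖v‖ * ‖w‖) ≤ c * ‖v‖ ^ 2 + 1 / c * ‖w‖ ^ 2 := by
    have : c * ‖v‖ ^ 2 + 1 / c * ‖w‖ ^ 2 - 2 * (‖v‖ * ‖w‖) = (c * ‖v‖ - ‖w‖) ^ 2 / c := by
      field_simp; ring
    have : 0 ≤ (c * ‖v‖ - ‖w‖) ^ 2 / c := by positivity
    linarith
  nlinarith

lemma norm_convexComb_sq_le {E : Type*} [SeminormedAddCommGroup E] [NormedSpace ℝ E] (v w : E)
    {β : ℝ} (h0 : 0 ≤ β) (h1 : β ≤ 1) :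
    ‖(1 - β) • v + β • w‖ ^ 2 ≤ (1 - β) * ‖v‖ ^ 2 + β * ‖w‖ ^ 2 := by
  have h : ‖(1 - β) • v + β • w‖ ≤ (1 - β) * ‖v‖ + β * ‖w‖ := by
    refine (norm_add_le _ _).trans_eq ?_
    rw [norm_smul, norm_smul, Real.norm_of_nonneg (by linarith), Real.norm_of_nonneg h0]
  have h2 : ‖(1 - β) • v + β • w‖ ^ 2 ≤ ((1 - β) * ‖v‖ + β * ‖w‖) ^ 2 := by gcongr
  nlinarith [mul_nonneg (mul_nonneg h0 (sub_nonneg.2 h1)) (sq_nonneg (‖v‖ - ‖w‖))]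

/-- Effect of a moving target on the tracking error of the momentum. -/
lemma contraction_sq_le {E : Type*} [SeminormedAddCommGroup E] (v w : E) {β : ℝ}
    (h0 : 0 < β) (h1 : β ≤ 1) :
    (1 - β) * ‖v + w‖ ^ 2 ≤ (1 - β / 2) * ‖v‖ ^ 2 + 2 / β * ‖w‖ ^ 2 := by
  have h := mul_le_mul_of_nonneg_left (norm_add_sq_le_weighted v w (half_pos h0))
    (sub_nonneg.2 h1)
  refine h.trans ?_
  have e : 1 / (β / 2) = 2 / β := by field_simp
  rw [e, mul_add]
  have a1 : (1 - β) * ((1 + β / 2) * ‖v‖ ^ 2) ≤ (1 - β / 2) * ‖v‖ ^ 2 := by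
    nlinarith [mul_nonneg (sq_nonneg β) (sq_nonneg ‖v‖)]
  have a2 : (1 - β) * (1 + 2 / β) ≤ 2 / β := by
    have : β * (2 / β) = 2 := by field_simp
    nlinarith
  nlinarith [mul_le_mul_of_nonneg_right a2 (sq_nonneg ‖w‖)]

variable {m g g' n : EuclideanSpace ℝ ι} {β : ℝ}

/-- Replacing the target g by g' costs a drift term: the factor 1 - β left by the momentum update is
split into the contraction 1 - β/2 and the price 2/β of that drift. Both momentum recursions below
use this. -/
lemma IsMask.tracking_le (hS : IsMask S) (h0 : 0 < β) (h1 : β ≤ 1) :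
    (1 - β) * ‖m - maskMul S g'‖ ^ 2
      ≤ (1 - β / 2) * ‖m - maskMul S g‖ ^ 2 + 2 / β * ‖g' - g‖ ^ 2 := by
  have e : m - maskMul S g' = (m - maskMul S g) + maskMul S (g - g') := by rw [map_sub]; abel
  rw [e]
  refine (contraction_sq_le _ _ h0 h1).trans ?_
  have := hS.norm_maskMul_sq_le (g - g')
  rw [norm_sub_rev g g'] at this
  gcongr

/-- Momentum error recursion when the mask is kept. -/
lemma IsMask.momentum_error_keep (hS : IsMask S) (hm : maskMul S m = m) (h0 : 0 < β)
    (h1 : β ≤ 1) :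
    ‖maskMul S ((1 - β) • m + β • (g' + n)) - maskMul S g'‖ ^ 2
      ≤ (1 - β / 2) * ‖m - maskMul S g‖ ^ 2 + 2 / β * ‖g' - g‖ ^ 2 + β ^ 2 * ‖n‖ ^ 2
        + inner ℝ ((2 * (1 - β) * β) • (m - maskMul S g')) n := by
  have e : maskMul S ((1 - β) • m + β • (g' + n)) - maskMul S g'
      = (1 - β) • (m - maskMul S g') + β • maskMul S n := by
    simp only [map_add, map_smul, hm]
    module
  -- The vector m - S ⊙ g' is supported on the mask, so the mask can be moved off n in the cross
  -- term. That term is kept exactly, because it vanishes only in expectation.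
  have e' : maskMul S (m - maskMul S g') = m - maskMul S g' := by
    rw [map_sub, hm, hS.maskMul_maskMul]
  rw [e, norm_sq_add_eq, norm_smul, norm_smul, mul_pow, mul_pow, Real.norm_eq_abs, sq_abs,
    Real.norm_eq_abs, sq_abs, real_inner_smul_left, real_inner_smul_right, real_inner_smul_left,
    inner_maskMul_right, e']
  have a1 := hS.tracking_le (m := m) (g := g) (g' := g') h0 h1
  have a2 : (1 - β) ^ 2 * ‖m - maskMul S g'‖ ^ 2 ≤ (1 - β) * ‖m - maskMul S g'‖ ^ 2 := by
    gcongr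
    nlinarith
  have a3 : β ^ 2 * ‖maskMul S n‖ ^ 2 ≤ β ^ 2 * ‖n‖ ^ 2 := by
    gcongr; exact hS.norm_maskMul_le n
  linarith

/-- Momentum error recursion when the mask changes from `S` to `S'`. -/
lemma IsMask.momentum_error_change {S' : EuclideanSpace ℝ ι} (hS : IsMask S) (hS' : IsMask S')
    (hm : maskMul S m = m) (h0 : 0 < β) (h1 : β ≤ 1) :
    ‖maskMul S' ((1 - β) • m + β • (g' + n)) - maskMul S' g'‖ ^ 2
      ≤ (1 - β / 2) * ‖m - maskMul S g‖ ^ 2 + 2 / β * ‖g' - g‖ ^ 2 + ‖g'‖ ^ 2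
        + β * ‖n‖ ^ 2 := by
  have e : maskMul S' ((1 - β) • m + β • (g' + n)) - maskMul S' g'
      = maskMul S' ((1 - β) • (m - g') + β • n) := by
    rw [← map_sub]; congr 1; module
  rw [e]
  refine (hS'.norm_maskMul_sq_le _).trans ((norm_convexComb_sq_le _ _ h0.le h1).trans ?_)
  have a1 := hS.tracking_le (m := m) (g := g) (g' := g') h0 h1
  -- Pythagoras over the old mask: on it m - g' equals m - S ⊙ g', and off it only -g' remains
  -- because m vanishes there.
  have a2 : ‖m - g'‖ ^ 2 ≤ ‖m - maskMul S g'‖ ^ 2 + ‖g'‖ ^ 2 := by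
    rw [hS.norm_sq_eq (m - g'), map_sub, hm]
    have : m - g' - (m - maskMul S g') = -(g' - maskMul S g') := by abel
    rw [this, norm_neg, hS.norm_sq_eq g']
    nlinarith [sq_nonneg ‖maskMul S g'‖]
  have a3 := mul_le_mul_of_nonneg_left a2 (sub_nonneg.2 h1)
  nlinarith [mul_nonneg h0.le (sq_nonneg ‖g'‖)]

/-- Momentum error of the first iteration. -/
lemma IsMask.momentum_error_init (hS : IsMask S) (h0 : 0 < β) (h1 : β ≤ 1) :
    ‖maskMul S (β • (g + n)) - maskMul S g‖ ^ 2 ≤ ‖g‖ ^ 2 + β * ‖n‖ ^ 2 := by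
  have e : maskMul S (β • (g + n)) - maskMul S g = maskMul S ((1 - β) • (-g) + β • n) := by
    rw [← map_sub]; congr 1; module
  rw [e]
  refine (hS.norm_maskMul_sq_le _).trans ((norm_convexComb_sq_le _ _ h0.le h1).trans ?_)
  rw [norm_neg]
  nlinarith [mul_nonneg h0.le (sq_nonneg ‖g‖)]

/-- A mask that retains a `δ`-fraction of the noisy gradient `g + n` also retains a part of `g`. -/
lemma IsMask.retained_le (hS : IsMask S) {δ : ℝ} (hδ0 : 0 ≤ δ) (hδ1 : δ ≤ 1)
    (h : δ * ‖g + n‖ ^ 2 ≤ ‖maskMul S (g + n)‖ ^ 2) :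
    δ * ‖g‖ ^ 2 ≤ 3 / 2 * ‖maskMul S g‖ ^ 2 + 12 * ‖n‖ ^ 2 := by
  have hs1 : √δ ≤ 1 := Real.sqrt_le_one.2 hδ1
  have hs0 := Real.sqrt_nonneg δ
  have hss : √δ ^ 2 = δ := Real.sq_sqrt hδ0
  have h' : √δ * ‖g + n‖ ≤ ‖maskMul S (g + n)‖ := by
    refine (sq_le_sq₀ (by positivity) (norm_nonneg _)).1 ?_
    rw [mul_pow, hss]; exact h
  have b1 : ‖g‖ ≤ ‖g + n‖ + ‖n‖ := by
    simpa using norm_sub_le (g + n) n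
  have b2 : ‖maskMul S (g + n)‖ ≤ ‖maskMul S g‖ + ‖n‖ := by
    rw [map_add]
    exact (norm_add_le _ _).trans (by gcongr; exact hS.norm_maskMul_le n)
  have b3 : √δ * ‖g‖ ≤ ‖maskMul S g‖ + 2 * ‖n‖ := by
    nlinarith [mul_le_mul_of_nonneg_left b1 hs0, mul_le_mul_of_nonneg_right hs1 (norm_nonneg n)]
  have b4 : (√δ * ‖g‖) ^ 2 ≤ (‖maskMul S g‖ + 2 * ‖n‖) ^ 2 := by gcongr
  rw [mul_pow, hss] at b4
  -- Young's inequality with weight 1/2: (a + 2b)² ≤ 3/2 a² + 3 (2b)², which gives the constants 3/2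
  -- and 12.
  nlinarith [sq_nonneg (‖maskMul S g‖ - 4 * ‖n‖)]

end Mask

/-! ### Descent for smooth functions. -/

section Smooth

variable {E : Type*} [NormedAddCommGroup E] [InnerProductSpace ℝ E] [CompleteSpace E]
  {f : E → ℝ} {L : ℝ}

/-- The quadratic upper bound for functions with Lipschitz gradient. -/
lemma le_quadratic_of_lipschitz_gradient (hf : Differentiable ℝ f)
    (hL : ∀ x y, ‖gradient f x - gradient f y‖ ≤ L * ‖x - y‖) (x d : E) :
    f (x + d) ≤ f x + inner ℝ (gradient f x) d + L / 2 * ‖d‖ ^ 2 := by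
  -- It suffices that φ decreases on [0, 1]: the quadratic term dominates the change of the gradient
  -- along the segment.
  let φ : ℝ → ℝ := fun s => f (x + s • d) - s * inner ℝ (gradient f x) d - L / 2 * ‖d‖ ^ 2 * s ^ 2
  have hφ : ∀ s, HasDerivAt φ (inner ℝ (gradient f (x + s • d)) d
      - inner ℝ (gradient f x) d - L / 2 * ‖d‖ ^ 2 * (2 * s)) s := by
    intro s
    have h1 : HasDerivAt (fun s : ℝ => x + s • d) d s := by
      simpa using ((hasDerivAt_id s).smul_const d).const_add x
    have h2 := (hf (x + s • d)).hasGradientAt.hasFDerivAt.comp_hasDerivAt s h1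
    have h3 := (hasDerivAt_id s).mul_const (inner ℝ (gradient f x) d)
    have h4 := ((hasDerivAt_id s).pow 2).const_mul (L / 2 * ‖d‖ ^ 2)
    exact ((h2.sub h3).sub h4).congr_deriv (by simp)
  have anti : AntitoneOn φ (Set.Icc 0 1) := by
    refine antitoneOn_of_deriv_nonpos (convex_Icc 0 1)
      (fun s _ => (hφ s).continuousAt.continuousWithinAt)
      (fun s _ => (hφ s).differentiableAt.differentiableWithinAt) fun s hs => ?_
    rw [interior_Icc] at hs
    rw [(hφ s).deriv, ← inner_sub_left]
    have h1 := real_inner_le_norm (gradient f (x + s • d) - gradient f x) d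
    have h2 := hL (x + s • d) x
    rw [add_sub_cancel_left, norm_smul, Real.norm_of_nonneg hs.1.le] at h2
    nlinarith [mul_le_mul_of_nonneg_right h2 (norm_nonneg d)]
  have h := anti (Set.left_mem_Icc.2 zero_le_one) (Set.right_mem_Icc.2 zero_le_one) zero_le_one
  simp only [φ, one_smul, zero_smul, add_zero] at h
  linarith

end Smooth

/-- One-step decrease of the objective under a masked step. -/
lemma descent_of_maskMul {ι : Type*} [Fintype ι] {S m x : EuclideanSpace ℝ ι}
    {f : EuclideanSpace ℝ ι → ℝ} {L η : ℝ} (hm : maskMul S m = m)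
    (hf : Differentiable ℝ f)
    (hL : ∀ x y, ‖gradient f x - gradient f y‖ ≤ L * ‖x - y‖) (hη : 0 < η) :
    η / 2 * ‖maskMul S (gradient f x)‖ ^ 2 + (1 / (2 * η) - L / 2) * ‖x - η • m - x‖ ^ 2
        - η / 2 * ‖m - maskMul S (gradient f x)‖ ^ 2
      ≤ f x - f (x - η • m) := by
  have h := le_quadratic_of_lipschitz_gradient hf hL x (-(η • m))
  have e1 : inner ℝ (gradient f x) (-(η • m)) = -(η * inner ℝ (maskMul S (gradient f x)) m) := by
    rw [inner_neg_right, inner_smul_right, ← inner_maskMul_right, hm]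
  -- Polarization trades the inner product of the descent inequality for the tracking error.
  have e2 : ‖m - maskMul S (gradient f x)‖ ^ 2
      = ‖m‖ ^ 2 - 2 * inner ℝ (maskMul S (gradient f x)) m + ‖maskMul S (gradient f x)‖ ^ 2 := by
    rw [norm_sub_sq_real, real_inner_comm]
  have e3 : ‖-(η • m)‖ ^ 2 = η ^ 2 * ‖m‖ ^ 2 := by
    rw [norm_neg, norm_smul, mul_pow, Real.norm_of_nonneg hη.le]
  have e4 : x - η • m - x = -(η • m) := by abel
  rw [e1, e3, ← sub_eq_add_neg] at h
  rw [e4, e3, e2]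
  have e5 : (1 / (2 * η) - L / 2) * (η ^ 2 * ‖m‖ ^ 2)
      = η / 2 * ‖m‖ ^ 2 - L / 2 * (η ^ 2 * ‖m‖ ^ 2) := by field_simp
  rw [e5]
  linarith

/-! ### Deterministic summation over periods. -/

lemma sum_range_mul_eq (f : ℕ → ℝ) (K τ : ℕ) :
    ∑ t ∈ Finset.range (K * τ), f t
      = ∑ r ∈ Finset.range K, ∑ s ∈ Finset.range τ, f (r * τ + s) := by
  induction K with
  | zero => simp
  | succ K ih => rw [Nat.succ_mul, Finset.sum_range_add, ih, Finset.sum_range_succ]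

/-- Sum of a sequence that satisfies a perturbed contraction. -/
lemma sum_le_of_contraction {E d c : ℕ → ℝ} {β : ℝ} (h1 : β ≤ 1)
    (hE : ∀ t, 0 ≤ E t) (hd : ∀ t, 0 ≤ d t) (h0 : E 0 ≤ c 0)
    (hs : ∀ t, E (t + 1) ≤ (1 - β / 2) * E t + d t + c (t + 1)) (T : ℕ) :
    β / 2 * ∑ t ∈ Finset.range T, E t
      ≤ ∑ t ∈ Finset.range T, d t + ∑ t ∈ Finset.range T, c t := by
  -- Carrying `E T` on the left makes the induction telescope: it provides the β/2 · `E T` of the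
  -- next sum and the (1 - β/2) `E T` of the recursion.
  have key : ∀ T, β / 2 * ∑ t ∈ Finset.range T, E t + E T
      ≤ ∑ t ∈ Finset.range T, d t + ∑ t ∈ Finset.range (T + 1), c t := by
    intro T
    induction T with
    | zero => simpa using h0
    | succ T ih =>
      rw [Finset.sum_range_succ E, Finset.sum_range_succ d, Finset.sum_range_succ c (T + 1)]
      linarith [hs T]
  cases T with
  | zero => simp
  | succ T =>
    rw [Finset.sum_range_succ E, Finset.sum_range_succ d]
    nlinarith [key T, hE T, hd T]

lemma sum_ite_dvd_le {A : ℕ → ℝ} {τ : ℕ} (hτ : 0 < τ) {a b : ℝ} (hb : 0 ≤ b) (K : ℕ) :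
    ∑ t ∈ Finset.range (K * τ), (if τ ∣ t then A t + a else b)
      ≤ ∑ r ∈ Finset.range K, A (r * τ) + K * a + K * τ * b := by
  rw [sum_range_mul_eq]
  have : ∀ r ∈ Finset.range K,
      ∑ s ∈ Finset.range τ, (if τ ∣ r * τ + s then A (r * τ + s) + a else b)
        ≤ A (r * τ) + (a + τ * b) := by
    intro r _
    obtain ⟨τ, rfl⟩ := Nat.exists_eq_succ_of_ne_zero hτ.ne'
    -- The first index of a period is its only multiple of τ; the other τ - 1 terms are bounded by
    -- the full τ · b.
    rw [Finset.sum_range_succ', add_zero, if_pos (Dvd.intro_left r rfl)]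
    have : ∑ s ∈ Finset.range τ,
        (if τ.succ ∣ r * τ.succ + (s + 1) then A (r * τ.succ + (s + 1)) + a else b) = τ * b := by
      rw [Finset.sum_congr rfl (g := fun _ => b)]
      · simp
      · intro s hs
        rw [if_neg]
        rw [Nat.dvd_add_right (Dvd.intro_left r rfl)]
        intro h
        have := Nat.le_of_dvd (Nat.succ_pos s) h
        have := Finset.mem_range.1 hs
        omega
    rw [this]
    push_cast
    linarith
  refine (Finset.sum_le_sum this).trans_eq ?_
  rw [Finset.sum_add_distrib, Finset.sum_const, Finset.card_range, nsmul_eq_mul]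
  ring

/-- Combination of the descent, tracking and drift inequalities over `K` periods of length `τ`. -/
lemma sum_le_of_recursions {A P D E Q : ℕ → ℝ} {L δ β η s V Δ : ℝ} {τ K : ℕ}
    (hL : 0 < L) (hδ0 : 0 < δ) (hδ1 : δ ≤ 1) (hβ0 : 0 < β) (hβ1 : β ≤ 1)
    (hτ : 64 / (3 * β * δ) ≤ τ) (hη : 0 < η) (hη1 : η ≤ 1 / (4 * L))
    (hη2 : η ≤ √(3 * δ * β ^ 2 / (80 * L ^ 2))) (hη3 : η ≤ √(δ / (40 * (τ : ℝ) ^ 2 * L ^ 2)))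
    (hA : ∀ t, 0 ≤ A t) (hP : ∀ t, 0 ≤ P t) (hD : ∀ t, 0 ≤ D t) (hE : ∀ t, 0 ≤ E t)
    (h1 : ∑ t ∈ Finset.range (K * τ), (η / 2 * P t + (1 / (2 * η) - L / 2) * D t - η / 2 * E t)
      ≤ Δ)
    (h2 : E 0 ≤ A 0 + β * V)
    (h3 : ∀ t, E (t + 1) ≤ (1 - β / 2) * E t + 2 / β * (L ^ 2 * D t)
      + if τ ∣ t + 1 then A (t + 1) + β * V else β ^ 2 * s ^ 2)
    (h4 : ∀ r, ∀ j < τ, A (r * τ + j) ≤ 3 / 2 * A (r * τ) + 3 * (L ^ 2 * Q (r * τ + j)))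
    (h5 : ∀ r, ∀ j < τ, δ * A (r * τ)
      ≤ 9 / 4 * P (r * τ + j) + 9 / 2 * (L ^ 2 * Q (r * τ + j)) + 12 * V)
    (h6 : ∀ r, ∀ j < τ, Q (r * τ + j) ≤ τ * ∑ i ∈ Finset.range τ, D (r * τ + i)) :
    ∑ t ∈ Finset.range (K * τ), A t ≤ 1 / δ * (32 / 3 * Δ / η + 24 * (K * τ) * V
      + 32 / 3 * K * V + 32 / 3 * β * (K * τ) * s ^ 2) := by
  have hτ0 : (0 : ℝ) < τ := lt_of_lt_of_le (by positivity) hτ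
  have hτn : 0 < τ := by exact_mod_cast hτ0
  set p := ∑ t ∈ Finset.range (K * τ), P t with hp
  set D' := ∑ t ∈ Finset.range (K * τ), D t with hD'
  set e := ∑ t ∈ Finset.range (K * τ), E t with he
  set q := ∑ t ∈ Finset.range (K * τ), L ^ 2 * Q t with hq
  set a := ∑ t ∈ Finset.range (K * τ), A t with ha
  set R := ∑ r ∈ Finset.range K, A (r * τ) with hR
  have p0 : 0 ≤ p := Finset.sum_nonneg fun t _ => hP t
  have D0 : 0 ≤ D' := Finset.sum_nonneg fun t _ => hD t
  have R0 : 0 ≤ R := Finset.sum_nonneg fun t _ => hA _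
  have tauR : ∑ r ∈ Finset.range K, ∑ _j ∈ Finset.range τ, A (r * τ) = τ * R := by
    simp [hR, Finset.mul_sum]
  -- summed recursions
  have s3 : β / 2 * e ≤ 2 / β * (L ^ 2 * D') + (R + K * (β * V) + K * τ * (β ^ 2 * s ^ 2)) := by
    have := sum_le_of_contraction (E := E) (d := fun t => 2 / β * (L ^ 2 * D t))
      (c := fun t => if τ ∣ t then A t + β * V else β ^ 2 * s ^ 2) hβ1 hE
      (fun t => by have := hD t; positivity) (by simpa using h2) h3 (K * τ)
    refine this.trans (add_le_add (le_of_eq ?_) (sum_ite_dvd_le hτn (by positivity) K))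
    rw [hD', Finset.mul_sum, Finset.mul_sum]
  have s4 : a ≤ 3 / 2 * (τ * R) + 3 * q := by
    rw [ha, hq, sum_range_mul_eq, sum_range_mul_eq, ← tauR, Finset.mul_sum, Finset.mul_sum,
      ← Finset.sum_add_distrib]
    refine Finset.sum_le_sum fun r _ => ?_
    rw [Finset.mul_sum, Finset.mul_sum, ← Finset.sum_add_distrib]
    exact Finset.sum_le_sum fun j hj => h4 r j (Finset.mem_range.1 hj)
  have s5 : δ * (τ * R) ≤ 9 / 4 * p + 9 / 2 * q + 12 * (K * τ * V) := by
    have e1 : 12 * (K * τ * V)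
        = ∑ r ∈ Finset.range K, ∑ _j ∈ Finset.range τ, 12 * V := by simp; ring
    rw [hp, hq, sum_range_mul_eq, sum_range_mul_eq, ← tauR, e1, Finset.mul_sum, Finset.mul_sum,
      Finset.mul_sum, ← Finset.sum_add_distrib, ← Finset.sum_add_distrib]
    refine Finset.sum_le_sum fun r _ => ?_
    rw [Finset.mul_sum, Finset.mul_sum, Finset.mul_sum, ← Finset.sum_add_distrib,
      ← Finset.sum_add_distrib]
    exact Finset.sum_le_sum fun j hj => h5 r j (Finset.mem_range.1 hj)
  have s6 : q ≤ L ^ 2 * (τ ^ 2 * D') := by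
    have : ∑ t ∈ Finset.range (K * τ), Q t ≤ τ ^ 2 * D' := by
      rw [hD', sum_range_mul_eq, sum_range_mul_eq, Finset.mul_sum]
      refine Finset.sum_le_sum fun r _ => ?_
      refine (Finset.sum_le_sum fun j hj => h6 r j (Finset.mem_range.1 hj)).trans_eq ?_
      rw [Finset.sum_const, Finset.card_range, nsmul_eq_mul]
      ring
    rw [hq, ← Finset.mul_sum]
    gcongr
  have s1 : η / 2 * p + (1 / (2 * η) - L / 2) * D' - η / 2 * e ≤ Δ := by
    rw [hp, hD', he, Finset.mul_sum, Finset.mul_sum, Finset.mul_sum, ← Finset.sum_add_distrib,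
      ← Finset.sum_sub_distrib]
    exact h1
  -- consequences of the step size conditions
  have b2 : L ^ 2 / β ^ 2 ≤ 3 / 80 * δ * (1 / η ^ 2) := by
    have : η ^ 2 ≤ 3 * δ * β ^ 2 / (80 * L ^ 2) := by
      rw [← Real.le_sqrt' hη]; exact hη2
    rw [le_div_iff₀ (by positivity)] at this
    rw [mul_one_div, div_le_div_iff₀ (by positivity) (by positivity)]
    linarith
  have b3 : L ^ 2 * τ ^ 2 ≤ 1 / 40 * δ * (1 / η ^ 2) := by
    have : η ^ 2 ≤ δ / (40 * (τ : ℝ) ^ 2 * L ^ 2) := by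
      rw [← Real.le_sqrt' hη]; exact hη3
    rw [le_div_iff₀ (by positivity)] at this
    rw [mul_one_div, le_div_iff₀ (by positivity)]
    linarith
  have b1 : L / η ≤ 1 / 4 * (1 / η ^ 2) := by
    rw [le_div_iff₀ (by positivity)] at hη1
    rw [mul_one_div, div_le_div_iff₀ (by positivity) (by positivity)]
    nlinarith
  have bτ : 2 / β ≤ 3 / 32 * (δ * τ) := by
    rw [div_le_iff₀ (by positivity)] at hτ
    rw [div_le_iff₀ hβ0]
    linarith
  set d := 1 / η ^ 2 * D' with hd
  have d0 : 0 ≤ d := by positivity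
  have t6 : q ≤ 1 / 40 * δ * d := by
    refine s6.trans ?_
    calc L ^ 2 * (τ ^ 2 * D') = L ^ 2 * τ ^ 2 * D' := by ring
      _ ≤ 1 / 40 * δ * (1 / η ^ 2) * D' := by gcongr
      _ = _ := by rw [hd]; ring
  have δd : δ * d ≤ d := mul_le_of_le_one_left d0 hδ1
  have t3 : e ≤ 3 / 20 * d + 3 / 32 * (δ * (τ * R)) + 2 * (K * V)
      + 2 * (β * (K * τ) * s ^ 2) := by
    have u1 : e ≤ 4 * (L ^ 2 / β ^ 2) * D' + 2 / β * R + 2 * (K * V)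
        + 2 * (β * (K * τ) * s ^ 2) := by
      have := mul_le_mul_of_nonneg_left s3 (show 0 ≤ 2 / β by positivity)
      have e1 : 2 / β * (β / 2 * e) = e := by field_simp
      rw [e1] at this
      refine this.trans_eq ?_
      field_simp
      ring
    have u2 : 4 * (L ^ 2 / β ^ 2) * D' ≤ 4 * (3 / 80 * δ * (1 / η ^ 2)) * D' := by gcongr
    have u3 : 2 / β * R ≤ 3 / 32 * (δ * τ) * R := by gcongr
    have u4 : 4 * (3 / 80 * δ * (1 / η ^ 2)) * D' = 3 / 20 * (δ * d) := by rw [hd]; ring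
    linarith
  have t1 : p + 3 / 4 * d - e ≤ 2 * (Δ / η) := by
    have := mul_le_mul_of_nonneg_left s1 (show 0 ≤ 2 / η by positivity)
    have e1 : 2 / η * (η / 2 * p + (1 / (2 * η) - L / 2) * D' - η / 2 * e)
        = p + (1 / η ^ 2 - L / η) * D' - e := by field_simp
    have e2 : 2 / η * Δ = 2 * (Δ / η) := by ring
    rw [e1, e2] at this
    have : (1 / η ^ 2 - 1 / 4 * (1 / η ^ 2)) * D' ≤ (1 / η ^ 2 - L / η) * D' := by gcongr
    have : (1 / η ^ 2 - 1 / 4 * (1 / η ^ 2)) * D' = 3 / 4 * d := by rw [hd]; ring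
    linarith
  have qδ : δ * q ≤ 1 / 40 * d := by
    have h := mul_le_mul_of_nonneg_left t6 hδ0.le
    have h' := mul_le_mul_of_nonneg_left δd hδ0.le
    linarith only [h, h', δd]
  have t4 : δ * a ≤ 3 / 2 * (δ * (τ * R)) + 3 * (δ * q) := by
    have := mul_le_mul_of_nonneg_left s4 hδ0.le
    linarith
  -- The weights are 1, 2, 16/3, 16/3 on `t4`, `s5`, `t1`, `t3`. The quantity δτR cancels exactly
  -- (3/2 + 1/2 = 2), p is left with 9/2 - 16/3 < 0, and the coefficient -4 + 4/5 of d outweighs the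
  -- 9/40 + 3/40 coming from the drift q.
  have fin : δ * a ≤ 32 / 3 * Δ / η + 24 * (K * τ) * V
      + 32 / 3 * K * V + 32 / 3 * β * (K * τ) * s ^ 2 := by
    have e1 : 32 / 3 * Δ / η = 32 / 3 * (Δ / η) := by ring
    have qd : q ≤ 1 / 40 * d := by linarith only [t6, δd]
    rw [e1]
    linarith only [t1, t3, t4, s5, qδ, qd, p0, d0]
  rw [one_div, ← div_eq_inv_mul, le_div_iff₀ hδ0, mul_comm]
  exact fin

/-- The drift within a window is controlled by the increments. -/
lemma norm_sub_sq_le_sum {E : Type*} [NormedAddCommGroup E] (x : ℕ → E) (a : ℕ)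
    {j τ : ℕ} (hj : j ≤ τ) :
    ‖x (a + j) - x a‖ ^ 2 ≤ τ * ∑ i ∈ Finset.range τ, ‖x (a + i + 1) - x (a + i)‖ ^ 2 := by
  have e : x (a + j) - x a = ∑ i ∈ Finset.range j, (x (a + i + 1) - x (a + i)) := by
    simpa [add_assoc] using (Finset.sum_range_sub (fun i => x (a + i)) j).symm
  rw [e]
  have h1 : ‖∑ i ∈ Finset.range j, (x (a + i + 1) - x (a + i))‖ ^ 2
      ≤ (∑ i ∈ Finset.range j, ‖x (a + i + 1) - x (a + i)‖) ^ 2 := by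
    gcongr; exact norm_sum_le _ _
  refine h1.trans ((sq_sum_le_card_mul_sum_sq).trans ?_)
  rw [Finset.card_range]
  gcongr

/-! ### Noise of the gradient oracle. -/

section Oracle

variable {N : ℕ} {m n : Fin N → ℕ}

lemma sum_frobSq_blocks (v : Params m n) : ∑ ℓ, frobSq (blocks v ℓ) = ‖v‖ ^ 2 := by
  rw [EuclideanSpace.real_norm_sq_eq, Fintype.sum_sigma]
  simp [frobSq, blocks, Fintype.sum_prod_type]

lemma blocks_sub (v w : Params m n) (ℓ : Fin N) : blocks (v - w) ℓ = blocks v ℓ - blocks w ℓ := by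
  ext i j; simp [blocks]

lemma totalSigma_sq (σ : Fin N → ℝ) : totalSigma σ ^ 2 = ∑ ℓ, σ ℓ ^ 2 :=
  Real.sq_sqrt (Finset.sum_nonneg fun _ _ => sq_nonneg _)

variable {Ξ : Type u} {f : Params m n → ℝ} {F : Params m n → Ξ → ℝ} {L : ℝ}

/-- The error of the stochastic gradient. -/
def gradNoise (f : Params m n → ℝ) (F : Params m n → Ξ → ℝ) (x : Params m n) (z : Ξ) :
    Params m n :=
  stochGrad F x z - gradient f x

lemma IsSmooth.continuous_gradient (hf : IsSmooth L f) : Continuous (gradient f) := by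
  have h : LipschitzWith (Real.toNNReal L) (gradient f) :=
    LipschitzWith.of_dist_le_mul fun x y => by
      rw [dist_eq_norm, dist_eq_norm]
      refine (hf.2 x y).trans ?_
      gcongr
      exact Real.le_coe_toNNReal L
  exact h.continuous

variable [MeasurableSpace Ξ] {𝒟 : Measure Ξ} {σ : Fin N → ℝ}

lemma IsGradientOracle.measurable_gradNoise (hF : IsGradientOracle f F 𝒟 σ) (hf : IsSmooth L f) :
    Measurable fun p : Params m n × Ξ => gradNoise f F p.1 p.2 :=
  hF.measurable.sub (hf.continuous_gradient.measurable.comp measurable_fst)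

lemma IsGradientOracle.integrable_norm_sq_gradNoise (hF : IsGradientOracle f F 𝒟 σ)
    (x : Params m n) : Integrable (fun z => ‖gradNoise f F x z‖ ^ 2) 𝒟 := by
  simp only [gradNoise, ← sum_frobSq_blocks, blocks_sub]
  exact integrable_finsetSum _ fun ℓ _ => hF.integrable_sq x ℓ

lemma IsGradientOracle.integral_norm_sq_gradNoise_le (hF : IsGradientOracle f F 𝒟 σ)
    (x : Params m n) : ∫ z, ‖gradNoise f F x z‖ ^ 2 ∂𝒟 ≤ totalSigma σ ^ 2 := by
  simp only [gradNoise, ← sum_frobSq_blocks, blocks_sub]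
  rw [integral_finsetSum _ fun ℓ _ => hF.integrable_sq x ℓ, totalSigma_sq]
  exact Finset.sum_le_sum fun ℓ _ => hF.variance_le x ℓ

lemma IsGradientOracle.integral_inner_gradNoise [IsProbabilityMeasure 𝒟]
    (hF : IsGradientOracle f F 𝒟 σ) (x w : Params m n) :
    ∫ z, inner ℝ w (gradNoise f F x z) ∂𝒟 = 0 := by
  have hi : ∀ p, Integrable (fun z => stochGrad F x z p) 𝒟 := fun p =>
    hF.integrable x p.1 p.2.1 p.2.2
  have h0 : ∀ p, ∫ z, stochGrad F x z p ∂𝒟 = gradient f x p := fun p =>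
    hF.unbiased x p.1 p.2.1 p.2.2
  simp only [PiLp.inner_apply, RCLike.inner_apply, conj_trivial, gradNoise, PiLp.sub_apply]
  have hi' : ∀ p, Integrable (fun z => (stochGrad F x z p - gradient f x p) * w p) 𝒟 :=
    fun p => ((hi p).sub (integrable_const _)).mul_const _
  rw [integral_finsetSum _ fun p _ => hi' p]
  refine Finset.sum_eq_zero fun p _ => ?_
  rw [integral_mul_const, integral_sub (hi p) (integrable_const _), h0 p]
  simp

end Oracle

/-! ### Independence of the samples. -/

section Stream

variable {Ω : Type v} [mΩ : MeasurableSpace Ω] {Ξ : Type u} [MeasurableSpace Ξ]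
  {μ : Measure Ω} {𝒟 : Measure Ξ} {ξ : ℕ → ℕ → Ω → Ξ}

/-- The σ-algebra generated by the samples with index in `A`. -/
abbrev sampleAlg (ξ : ℕ → ℕ → Ω → Ξ) (A : Set (ℕ × ℕ)) : MeasurableSpace Ω :=
  ⨆ p ∈ A, MeasurableSpace.comap (ξ p.1 p.2) inferInstance

omit mΩ in
lemma sampleAlg_mono {A A' : Set (ℕ × ℕ)} (h : A ⊆ A') : sampleAlg ξ A ≤ sampleAlg ξ A' :=
  biSup_mono h

omit mΩ in
lemma measurable_sampleAlg {A : Set (ℕ × ℕ)} {t b : ℕ} (h : (t, b) ∈ A) :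
    Measurable[sampleAlg ξ A] (ξ t b) := by
  refine Measurable.mono (comap_measurable (ξ t b)) ?_ le_rfl
  exact le_iSup₂ (f := fun (p : ℕ × ℕ) (_ : p ∈ A) =>
    MeasurableSpace.comap (ξ p.1 p.2) inferInstance) (t, b) h

lemma IsSampleStream.sampleAlg_le (h : IsSampleStream μ 𝒟 ξ) (A : Set (ℕ × ℕ)) :
    sampleAlg ξ A ≤ mΩ :=
  iSup₂_le fun p _ => (h.measurable p.1 p.2).comap_le

/-- A function of the samples in `A` is independent of any sample outside `A`. -/
lemma IsSampleStream.map_prod [IsProbabilityMeasure μ] (h : IsSampleStream μ 𝒟 ξ)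
    {A : Set (ℕ × ℕ)} {t b : ℕ} (hp : (t, b) ∉ A) {γ : Type*} [mγ : MeasurableSpace γ] {Y : Ω → γ}
    (hY : Measurable[sampleAlg ξ A] Y) :
    μ.map (fun ω => (Y ω, ξ t b ω)) = (μ.map Y).prod 𝒟 := by
  have hYm : Measurable Y := hY.mono (h.sampleAlg_le A) le_rfl
  have hind : Indep (sampleAlg ξ A) (MeasurableSpace.comap (ξ t b) inferInstance) μ := by
    have := indep_iSup_of_disjoint (m := fun p : ℕ × ℕ =>
      MeasurableSpace.comap (ξ p.1 p.2) inferInstance)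
      (fun p => (h.measurable p.1 p.2).comap_le) h.indep.iIndep
      (Set.disjoint_singleton_right.2 hp)
    simpa [sampleAlg] using this
  have hfun : IndepFun Y (ξ t b) μ :=
    (IndepFun_iff_Indep _ _ _).2 (indep_of_indep_of_le_left hind hY.comap_le)
  rw [(indepFun_iff_map_prod_eq_prod_map_map hYm.aemeasurable
    (h.measurable t b).aemeasurable).1 hfun, h.law]

end Stream

/-! ### Moments of fresh gradient noise. -/

section Expectation

variable {N : ℕ} {m n : Fin N → ℕ} {Ω : Type v} [MeasurableSpace Ω] {Ξ : Type u}
  [MeasurableSpace Ξ] {μ : Measure Ω} [IsProbabilityMeasure μ] {𝒟 : Measure Ξ}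
  [IsProbabilityMeasure 𝒟] {f : Params m n → ℝ} {F : Params m n → Ξ → ℝ} {L : ℝ}
  {σ : Fin N → ℝ} {ξ : ℕ → ℕ → Ω → Ξ} {A : Set (ℕ × ℕ)} {t b : ℕ} {X U : Ω → Params m n}

omit [IsProbabilityMeasure μ] [IsProbabilityMeasure 𝒟] in
lemma measurable_gradNoise_sample (hf : IsSmooth L f) (hF : IsGradientOracle f F 𝒟 σ)
    (hξ : IsSampleStream μ 𝒟 ξ) (hX : Measurable[sampleAlg ξ A] X) :
    Measurable fun ω => gradNoise f F (X ω) (ξ t b ω) := by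
  have h : Measurable fun ω => (X ω, ξ t b ω) :=
    (hX.mono (hξ.sampleAlg_le A) le_rfl).prodMk (hξ.measurable t b)
  have h' := (hF.measurable_gradNoise hf).comp h
  exact h'

/-- The pair (X, fresh sample) has a product law, so Fubini freezes X at a point x. The variance
bound is uniform in x, which yields both integrability and the estimate. -/
lemma integrable_and_integral_norm_sq_gradNoise_sample (hf : IsSmooth L f) (hF : IsGradientOracle f F 𝒟 σ)
    (hξ : IsSampleStream μ 𝒟 ξ) (hX : Measurable[sampleAlg ξ A] X) (hp : (t, b) ∉ A) :
    Integrable (fun ω => ‖gradNoise f F (X ω) (ξ t b ω)‖ ^ 2) μ ∧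
      ∫ ω, ‖gradNoise f F (X ω) (ξ t b ω)‖ ^ 2 ∂μ ≤ totalSigma σ ^ 2 := by
  have hXm : Measurable X := hX.mono (hξ.sampleAlg_le A) le_rfl
  have hpair : Measurable fun ω => (X ω, ξ t b ω) := hXm.prodMk (hξ.measurable t b)
  have hg : Measurable fun p : Params m n × Ξ => ‖gradNoise f F p.1 p.2‖ ^ 2 :=
    (hF.measurable_gradNoise hf).norm.pow_const 2
  have hlaw := hξ.map_prod hp hX
  have : IsProbabilityMeasure (μ.map X) := Measure.isProbabilityMeasure_map hXm.aemeasurable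
  have hb : ∀ x, ∫ z, ‖gradNoise f F x z‖ ^ 2 ∂𝒟 ≤ totalSigma σ ^ 2 :=
    hF.integral_norm_sq_gradNoise_le
  have hi : Integrable (fun p : Params m n × Ξ => ‖gradNoise f F p.1 p.2‖ ^ 2)
      ((μ.map X).prod 𝒟) := by
    rw [integrable_prod_iff hg.aestronglyMeasurable]
    refine ⟨Filter.Eventually.of_forall hF.integrable_norm_sq_gradNoise, ?_⟩
    refine Integrable.of_bound
      hg.norm.stronglyMeasurable.integral_prod_right'.aestronglyMeasurable (totalSigma σ ^ 2)
      (Filter.Eventually.of_forall fun x => ?_)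
    simp only [norm_pow, norm_norm]
    rw [Real.norm_of_nonneg (integral_nonneg fun _ => sq_nonneg _)]
    exact hb x
  have e : ∫ ω, ‖gradNoise f F (X ω) (ξ t b ω)‖ ^ 2 ∂μ
      = ∫ x, ∫ z, ‖gradNoise f F x z‖ ^ 2 ∂𝒟 ∂(μ.map X) := by
    rw [← integral_prod _ hi, ← hlaw, integral_map hpair.aemeasurable hg.aestronglyMeasurable]
  constructor
  · rw [← hlaw] at hi
    exact (integrable_map_measure hg.aestronglyMeasurable hpair.aemeasurable).1 hi
  · rw [e]
    refine (integral_mono hi.integral_prod_left (integrable_const (totalSigma σ ^ 2)) hb).trans_eq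
      ?_
    simp

lemma memLp_gradNoise (hf : IsSmooth L f) (hF : IsGradientOracle f F 𝒟 σ)
    (hξ : IsSampleStream μ 𝒟 ξ) (hX : Measurable[sampleAlg ξ A] X) (hp : (t, b) ∉ A) :
    MemLp (fun ω => gradNoise f F (X ω) (ξ t b ω)) 2 μ :=
  (memLp_two_iff_integrable_sq_norm
    (measurable_gradNoise_sample hf hF hξ hX).aestronglyMeasurable).2
    (integrable_and_integral_norm_sq_gradNoise_sample hf hF hξ hX hp).1

omit [IsProbabilityMeasure μ] in
lemma _root_.MeasureTheory.MemLp.integrable_inner_of_two {V : Type*} [NormedAddCommGroup V]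
    [InnerProductSpace ℝ V] {v w : Ω → V} (hv : MemLp v 2 μ) (hw : MemLp w 2 μ) :
    Integrable (fun ω => inner ℝ (v ω) (w ω)) μ := by
  refine Integrable.mono' ((hv.integrable_norm_pow two_ne_zero).add
    (hw.integrable_norm_pow two_ne_zero)) (hv.1.inner hw.1) (Filter.Eventually.of_forall fun ω => ?_)
  refine (norm_inner_le_norm (v ω) (w ω)).trans ?_
  simp only [Pi.add_apply]
  nlinarith [sq_nonneg (‖v ω‖ - ‖w ω‖), sq_nonneg ‖v ω‖, sq_nonneg ‖w ω‖]

/-- The error of a fresh stochastic gradient is orthogonal to the past. -/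
lemma integral_inner_gradNoise_sample (hf : IsSmooth L f) (hF : IsGradientOracle f F 𝒟 σ)
    (hξ : IsSampleStream μ 𝒟 ξ) (hX : Measurable[sampleAlg ξ A] X)
    (hU : Measurable[sampleAlg ξ A] U) (hU2 : MemLp U 2 μ) (hp : (t, b) ∉ A) :
    ∫ ω, inner ℝ (U ω) (gradNoise f F (X ω) (ξ t b ω)) ∂μ = 0 := by
  have hXU : Measurable[sampleAlg ξ A] fun ω => (X ω, U ω) :=
    hX.prodMk hU
  have hpair : Measurable fun ω => ((X ω, U ω), ξ t b ω) :=
    (hXU.mono (hξ.sampleAlg_le A) le_rfl).prodMk (hξ.measurable t b)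
  have hg : Measurable fun p : (Params m n × Params m n) × Ξ =>
      inner ℝ p.1.2 (gradNoise f F p.1.1 p.2) := by
    have h : Measurable fun p : (Params m n × Params m n) × Ξ => (p.1.1, p.2) := by fun_prop
    have h' := (hF.measurable_gradNoise hf).comp h
    exact Measurable.inner (measurable_snd.comp measurable_fst) h'
  -- The past enters as the pair (X, U); with both frozen, the inner integral vanishes by
  -- unbiasedness.
  have hlaw := hξ.map_prod hp hXU
  have hi : Integrable (fun p : (Params m n × Params m n) × Ξ =>
      inner ℝ p.1.2 (gradNoise f F p.1.1 p.2)) ((μ.map fun ω => (X ω, U ω)).prod 𝒟) := by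
    rw [← hlaw, integrable_map_measure hg.aestronglyMeasurable hpair.aemeasurable]
    exact hU2.integrable_inner_of_two (memLp_gradNoise hf hF hξ hX hp)
  have e : ∫ ω, inner ℝ (U ω) (gradNoise f F (X ω) (ξ t b ω)) ∂μ
      = ∫ y, ∫ z, inner ℝ y.2 (gradNoise f F y.1 z) ∂𝒟 ∂(μ.map fun ω => (X ω, U ω)) := by
    rw [← integral_prod _ hi, ← hlaw, integral_map hpair.aemeasurable hg.aestronglyMeasurable]
  rw [e]
  simp [hF.integral_inner_gradNoise]

/-- The error of the average of `B` fresh stochastic gradients. -/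
lemma batch_gradNoise (hf : IsSmooth L f) (hF : IsGradientOracle f F 𝒟 σ)
    (hξ : IsSampleStream μ 𝒟 ξ) (hX : Measurable[sampleAlg ξ A] X) (hp : ∀ b, (t, b) ∉ A) (B : ℕ) :
    MemLp (fun ω => ∑ b ∈ Finset.range B, gradNoise f F (X ω) (ξ t b ω)) 2 μ ∧
      ∫ ω, ‖∑ b ∈ Finset.range B, gradNoise f F (X ω) (ξ t b ω)‖ ^ 2 ∂μ
        ≤ B * totalSigma σ ^ 2 := by
  have hmem : ∀ B, MemLp (fun ω => ∑ b ∈ Finset.range B, gradNoise f F (X ω) (ξ t b ω)) 2 μ :=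
    fun B => memLp_finsetSum _ fun b _ => memLp_gradNoise hf hF hξ hX (hp b)
  refine ⟨hmem B, ?_⟩
  induction B with
  | zero => simp
  | succ B ih =>
    -- The samples of iteration t with index below B join the past, so that their partial sum is
    -- orthogonal to the noise of sample number B.
    let A' : Set (ℕ × ℕ) := A ∪ {p | p.1 = t ∧ p.2 < B}
    have hp' : (t, B) ∉ A' := by simp [A', hp B]
    have hX' : Measurable[sampleAlg ξ A'] X := hX.mono (sampleAlg_mono Set.subset_union_left) le_rfl
    have hU : Measurable[sampleAlg ξ A']
        fun ω => ∑ b ∈ Finset.range B, gradNoise f F (X ω) (ξ t b ω) := by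
      refine @Finset.measurable_fun_sum _ _ _ _ _ _ (sampleAlg ξ A') _ _ fun b hb => ?_
      have hs : Measurable[sampleAlg ξ A'] (ξ t b) :=
        measurable_sampleAlg (Or.inr ⟨rfl, Finset.mem_range.1 hb⟩)
      have h : Measurable[sampleAlg ξ A'] fun ω => (X ω, ξ t b ω) := hX'.prodMk hs
      have h' := (hF.measurable_gradNoise hf).comp h
      exact h'
    have h0 := integral_inner_gradNoise_sample hf hF hξ hX' hU (hmem B) hp'
    have hn := memLp_gradNoise hf hF hξ hX (hp B)
    simp only [Finset.sum_range_succ, norm_sq_add_eq]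
    rw [integral_add, integral_add, integral_const_mul, h0]
    · push_cast
      linarith [(integrable_and_integral_norm_sq_gradNoise_sample hf hF hξ hX (hp B)).2]
    · exact (hmem B).integrable_norm_pow two_ne_zero
    · exact ((hmem B).integrable_inner_of_two hn).const_mul _
    · exact ((hmem B).integrable_norm_pow two_ne_zero).add
        (((hmem B).integrable_inner_of_two hn).const_mul _)
    · exact hn.integrable_norm_pow two_ne_zero

end Expectation

/-! ### Energy retained by a Top-k mask. -/

section TopK

/-- Each selected square dominates each discarded one. Summing over all such pairs gives k ·
(discarded energy) ≤ (ab - k) · (retained energy); then k · (retained energy) is added to both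
sides. -/
lemma IsTopKMask.density_le {a b k : ℕ} {G S : Matrix (Fin a) (Fin b) ℝ}
    (h : IsTopKMask k G S) : k * frobSq G ≤ (a * b : ℝ) * frobSq (S ⊙ G) := by
  classical
  let s : Fin a × Fin b → ℝ := fun p => S p.1 p.2
  let g : Fin a × Fin b → ℝ := fun p => G p.1 p.2 ^ 2
  have hs : ∀ p, s p = 0 ∨ s p = 1 := fun p => h.1.1 p.1 p.2
  have hk : ∑ p, s p = k := by
    rw [← h.1.2, frobSq, Fintype.sum_prod_type]
    refine Finset.sum_congr rfl fun i _ => Finset.sum_congr rfl fun j _ => ?_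
    rcases h.1.1 i j with h | h <;> simp [s, h]
  have hG : frobSq G = ∑ p, g p := by rw [Fintype.sum_prod_type]; rfl
  have hSG : frobSq (S ⊙ G) = ∑ p, s p * g p := by
    rw [Fintype.sum_prod_type, frobSq]
    refine Finset.sum_congr rfl fun i _ => Finset.sum_congr rfl fun j _ => ?_
    rcases h.1.1 i j with h | h <;> simp [s, g, h]
  have hcard : (a * b : ℝ) = ∑ _p : Fin a × Fin b, (1 : ℝ) := by simp
  have key : ∀ p q, s p * ((1 - s q) * g q) ≤ (1 - s q) * (s p * g p) := by
    intro p q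
    rcases hs p with hp | hp <;> rcases hs q with hq | hq <;> simp only [hp, hq] <;> try simp
    simpa [g, sq_abs] using sq_le_sq.2 (h.2 p.1 p.2 q.1 q.2 hp hq)
  have hsum : (∑ p, s p) * ∑ q, (1 - s q) * g q ≤ (∑ q, (1 - s q)) * ∑ p, s p * g p := by
    rw [Finset.sum_mul_sum, Finset.sum_mul_sum, Finset.sum_comm]
    exact Finset.sum_le_sum fun q _ => Finset.sum_le_sum fun p _ => key p q
  have e1 : ∑ q, (1 - s q) * g q = ∑ q, g q - ∑ q, s q * g q := by
    rw [← Finset.sum_sub_distrib]; exact Finset.sum_congr rfl fun q _ => by ring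
  rw [e1, Finset.sum_sub_distrib, hk, ← hcard] at hsum
  rw [hG, hSG]
  linarith

end TopK

/-! ### Recursions satisfied by the run. -/

section Run

variable {N : ℕ} {m n k : Fin N → ℕ} {Ω : Type v} {Ξ : Type u} (F : Params m n → Ξ → ℝ)
  (topk : (ℓ : Fin N) → Matrix (Fin (m ℓ)) (Fin (n ℓ)) ℝ → Matrix (Fin (m ℓ)) (Fin (n ℓ)) ℝ)
  (β η : ℝ) (τ B : ℕ) (x₀ : Params m n) (ξ : ℕ → ℕ → Ω → Ξ)

/-- The gradient estimates `G^{(t)}` of the run, as a parameter vector. -/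
def runGrad (t : ℕ) (ω : Ω) : Params m n :=
  assemble (gradEst F τ B t (fun b => ξ t b ω) (iterate F topk β η τ B x₀ ξ t ω))

/-- The masks `S^{(t)}` of the run, as a parameter vector. -/
def runMask (t : ℕ) (ω : Ω) : Params m n :=
  assemble (run F topk β η τ B x₀ (fun s b => ξ s b ω) (t + 1)).S

/-- The momenta `M^{(t)}` of the run, as a parameter vector. -/
def runMomentum (t : ℕ) (ω : Ω) : Params m n :=
  assemble (run F topk β η τ B x₀ (fun s b => ξ s b ω) (t + 1)).M

variable {F topk β η τ B x₀ ξ} {t : ℕ} {ω : Ω}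

lemma runMask_of_dvd (h : τ ∣ t) : runMask F topk β η τ B x₀ ξ t ω
    = assemble fun ℓ => topk ℓ
      (gradEst F τ B t (fun b => ξ t b ω) (iterate F topk β η τ B x₀ ξ t ω) ℓ) := by
  simp [runMask, run, step, h, iterate]

lemma runMask_succ (h : ¬ τ ∣ t + 1) :
    runMask F topk β η τ B x₀ ξ (t + 1) ω = runMask F topk β η τ B x₀ ξ t ω := by
  rw [runMask, run]
  simp [step, h, runMask]

lemma runMomentum_zero : runMomentum F topk β η τ B x₀ ξ 0 ω
    = maskMul (runMask F topk β η τ B x₀ ξ 0 ω)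
      (β • runGrad F topk β η τ B x₀ ξ 0 ω) := by
  ext ⟨ℓ, i, j⟩
  simp [runMomentum, runMask, runGrad, run, step, assemble, iterate]

lemma runMomentum_succ : runMomentum F topk β η τ B x₀ ξ (t + 1) ω
    = maskMul (runMask F topk β η τ B x₀ ξ (t + 1) ω)
      ((1 - β) • runMomentum F topk β η τ B x₀ ξ t ω
        + β • runGrad F topk β η τ B x₀ ξ (t + 1) ω) := by
  rw [runMomentum, runMask, run]
  generalize hs : run F topk β η τ B x₀ (fun s b => ξ s b ω) (t + 1) = s
  ext ⟨ℓ, i, j⟩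
  simp [runMomentum, runGrad, step, assemble, iterate, hs]

lemma iterate_succ : iterate F topk β η τ B x₀ ξ (t + 1) ω
    = iterate F topk β η τ B x₀ ξ t ω
      - η • maskMul (runMask F topk β η τ B x₀ ξ t ω) (runMomentum F topk β η τ B x₀ ξ t ω) := by
  rw [iterate, runMask, runMomentum, run]
  ext ⟨ℓ, i, j⟩
  simp [step, assemble, iterate, blocks]

lemma isMask_runMask (htop : ∀ ℓ, IsTopKRule (k ℓ) (topk ℓ)) (t : ℕ) :
    IsMask (runMask F topk β η τ B x₀ ξ t ω) := by
  induction t with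
  | zero =>
    rw [runMask_of_dvd (dvd_zero τ)]
    exact fun p => ((htop p.1).2 _).1.1 p.2.1 p.2.2
  | succ t ih =>
    by_cases h : τ ∣ t + 1
    · rw [runMask_of_dvd h]
      exact fun p => ((htop p.1).2 _).1.1 p.2.1 p.2.2
    · rw [runMask_succ h]
      exact ih

lemma runMask_eq_of_lt (r : ℕ) {j : ℕ} (hj : j < τ) :
    runMask F topk β η τ B x₀ ξ (r * τ + j) ω = runMask F topk β η τ B x₀ ξ (r * τ) ω := by
  induction j with
  | zero => rfl
  | succ j ih =>
    rw [← ih (by omega), ← add_assoc, runMask_succ]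
    rw [add_assoc, Nat.dvd_add_right (Dvd.intro_left r rfl)]
    intro h
    exact absurd (Nat.le_of_dvd (Nat.succ_pos j) h) (by omega)

lemma maskMul_runMomentum (htop : ∀ ℓ, IsTopKRule (k ℓ) (topk ℓ)) (t : ℕ) :
    maskMul (runMask F topk β η τ B x₀ ξ t ω) (runMomentum F topk β η τ B x₀ ξ t ω)
      = runMomentum F topk β η τ B x₀ ξ t ω := by
  cases t with
  | zero => rw [runMomentum_zero, (isMask_runMask htop 0).maskMul_maskMul]
  | succ t => rw [runMomentum_succ, (isMask_runMask htop (t + 1)).maskMul_maskMul]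

lemma minDensity_mul_le (hk : ∀ ℓ, 1 ≤ k ℓ ∧ k ℓ ≤ m ℓ * n ℓ)
    (htop : ∀ ℓ, IsTopKRule (k ℓ) (topk ℓ)) (h : τ ∣ t) :
    minDensity m n k * ‖runGrad F topk β η τ B x₀ ξ t ω‖ ^ 2
      ≤ ‖maskMul (runMask F topk β η τ B x₀ ξ t ω) (runGrad F topk β η τ B x₀ ξ t ω)‖ ^ 2 := by
  rw [← sum_frobSq_blocks, ← sum_frobSq_blocks, Finset.mul_sum, runMask_of_dvd h]
  refine Finset.sum_le_sum fun ℓ _ => ?_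
  have hG := ((htop ℓ).2 (gradEst F τ B t (fun b => ξ t b ω)
    (iterate F topk β η τ B x₀ ξ t ω) ℓ)).density_le
  have hpos : (0 : ℝ) < (m ℓ : ℝ) * n ℓ := by
    have : 0 < m ℓ * n ℓ := lt_of_lt_of_le (hk ℓ).1 (hk ℓ).2
    exact_mod_cast this
  have h1 : minDensity m n k ≤ (k ℓ : ℝ) / ((m ℓ : ℝ) * (n ℓ : ℝ)) :=
    ciInf_le (Set.finite_range _).bddBelow ℓ
  have h2 : 0 ≤ frobSq (blocks (runGrad F topk β η τ B x₀ ξ t ω) ℓ) :=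
    Finset.sum_nonneg fun _ _ => Finset.sum_nonneg fun _ _ => sq_nonneg _
  refine (mul_le_mul_of_nonneg_right h1 h2).trans ?_
  rw [div_mul_eq_mul_div, div_le_iff₀ hpos, mul_comm (frobSq _)]
  exact hG

lemma minDensity_pos (hN : 0 < N) (hk : ∀ ℓ, 1 ≤ k ℓ ∧ k ℓ ≤ m ℓ * n ℓ) :
    0 < minDensity m n k := by
  have : Nonempty (Fin N) := ⟨⟨0, hN⟩⟩
  obtain ⟨ℓ, hℓ⟩ := exists_eq_ciInf_of_finite
    (f := fun ℓ : Fin N => (k ℓ : ℝ) / ((m ℓ : ℝ) * (n ℓ : ℝ)))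
  rw [minDensity, ← hℓ]
  have h1 : 0 < k ℓ := (hk ℓ).1
  have h2 : 0 < m ℓ * n ℓ := h1.trans_le (hk ℓ).2
  have h3 : (0 : ℝ) < (m ℓ : ℝ) * n ℓ := by exact_mod_cast h2
  positivity

lemma minDensity_le_one (hN : 0 < N) (hk : ∀ ℓ, 1 ≤ k ℓ ∧ k ℓ ≤ m ℓ * n ℓ) :
    minDensity m n k ≤ 1 := by
  refine (ciInf_le (Set.finite_range _).bddBelow ⟨0, hN⟩).trans (div_le_one_of_le₀ ?_ ?_)
  · exact_mod_cast (hk ⟨0, hN⟩).2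
  · positivity

end Run

/-! ### Adaptedness of the run. -/

section Measurability

variable {N : ℕ} {m n k : Fin N → ℕ} {Ω : Type v} [mΩ : MeasurableSpace Ω] {Ξ : Type u}
  [MeasurableSpace Ξ] {F : Params m n → Ξ → ℝ}
  {topk : (ℓ : Fin N) → Matrix (Fin (m ℓ)) (Fin (n ℓ)) ℝ → Matrix (Fin (m ℓ)) (Fin (n ℓ)) ℝ}
  {β η : ℝ} {τ B : ℕ} {x₀ : Params m n} {ξ : ℕ → ℕ → Ω → Ξ} {t : ℕ}

lemma measurable_params {x : Ω → Params m n}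
    (h : ∀ ℓ i j, Measurable fun ω => blocks (x ω) ℓ i j) : Measurable x := by
  have h1 : Measurable fun ω p => x ω p := measurable_pi_iff.2 fun p => h p.1 p.2.1 p.2.2
  exact (WithLp.measurable_toLp 2 _).comp h1

lemma measurable_blocks_apply {x : Ω → Params m n} (h : Measurable x) (ℓ : Fin N)
    (i : Fin (m ℓ)) (j : Fin (n ℓ)) : Measurable fun ω => blocks (x ω) ℓ i j := by
  have h1 : Measurable fun v : Params m n => v ⟨ℓ, i, j⟩ := by fun_prop
  exact h1.comp h

lemma measurable_gradEst (hF : Measurable fun p : Params m n × Ξ => stochGrad F p.1 p.2)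
    {x : Ω → Params m n} (hx : Measurable x) {ζ : ℕ → Ω → Ξ} (hζ : ∀ b, Measurable (ζ b))
    (ℓ : Fin N) (i : Fin (m ℓ)) (j : Fin (n ℓ)) :
    Measurable fun ω => gradEst F τ B t (fun b => ζ b ω) (x ω) ℓ i j := by
  have h : ∀ b, Measurable fun ω => blocks (stochGrad F (x ω) (ζ b ω)) ℓ i j := by
    intro b
    have h1 : Measurable fun ω => (x ω, ζ b ω) := hx.prodMk (hζ b)
    have h2 := hF.comp h1
    exact measurable_blocks_apply h2 ℓ i j
  by_cases hd : τ ∣ t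
  · simp only [gradEst, hd, if_true, Matrix.smul_apply, Matrix.sum_apply, smul_eq_mul]
    exact (Finset.measurable_fun_sum _ fun b _ => h b).const_mul _
  · simp only [gradEst, hd, if_false]
    exact h 0

/-- Only samples of iterations before t have to be measurable. Hence the σ-algebra on Ω may be taken
to be the one generated by those samples, and the lemma then says that the run is adapted. -/
lemma measurable_run (hF : Measurable fun p : Params m n × Ξ => stochGrad F p.1 p.2)
    (htop : ∀ ℓ, IsTopKRule (k ℓ) (topk ℓ)) (t : ℕ)
    (hξ : ∀ s < t, ∀ b, Measurable (ξ s b)) :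
    Measurable (fun ω => (run F topk β η τ B x₀ (fun s b => ξ s b ω) t).x) ∧
    (∀ ℓ i j, Measurable fun ω => (run F topk β η τ B x₀ (fun s b => ξ s b ω) t).S ℓ i j) ∧
    (∀ ℓ i j, Measurable fun ω => (run F topk β η τ B x₀ (fun s b => ξ s b ω) t).M ℓ i j) := by
  induction t with
  | zero =>
    simp only [run]
    exact ⟨measurable_const, fun _ _ _ => measurable_const, fun _ _ _ => measurable_const⟩
  | succ t ih =>
    obtain ⟨hx, hS, hM⟩ := ih fun s hs => hξ s (hs.trans t.lt_succ_self)
    have hG := fun ℓ i j => measurable_gradEst (B := B) (τ := τ) (t := t) hF hx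
      (hξ t t.lt_succ_self) ℓ i j
    have hS' : ∀ ℓ i j, Measurable fun ω =>
        (run F topk β η τ B x₀ (fun s b => ξ s b ω) (t + 1)).S ℓ i j := by
      intro ℓ i j
      by_cases hd : τ ∣ t
      · simp only [run, step, hd, if_true]
        have h1 : Measurable fun ω i j => gradEst F τ B t (fun b => ξ t b ω)
            (run F topk β η τ B x₀ (fun s b => ξ s b ω) t).x ℓ i j :=
          measurable_pi_iff.2 fun i => measurable_pi_iff.2 fun j => hG ℓ i j
        have h2 := (htop ℓ).1.comp h1
        exact (measurable_pi_iff.1 (measurable_pi_iff.1 h2 i) j)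
      · simp only [run, step, hd, if_false]
        exact hS ℓ i j
    have hM' : ∀ ℓ i j, Measurable fun ω =>
        (run F topk β η τ B x₀ (fun s b => ξ s b ω) (t + 1)).M ℓ i j := by
      intro ℓ i j
      exact (((hS' ℓ i j).mul (hM ℓ i j)).const_mul (1 - β)).add
        (((hS' ℓ i j).mul (hG ℓ i j)).const_mul β)
    refine ⟨measurable_params fun ℓ i j => ?_, hS', hM'⟩
    exact (measurable_blocks_apply hx ℓ i j).sub
      (((hS' ℓ i j).mul (hM' ℓ i j)).const_mul η)

end Measurability

/-! ### Integration of pointwise inequalities. -/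

section Integral

variable {Ω : Type*} [MeasurableSpace Ω] {μ : Measure Ω} {a b c d e : Ω → ℝ} {p q r s : ℝ}

lemma integral_le_add_four (ha : Integrable a μ) (hb : Integrable b μ) (hc : Integrable c μ)
    (hd : Integrable d μ) (he : Integrable e μ)
    (h : ∀ ω, a ω ≤ p * b ω + q * c ω + r * d ω + s * e ω) :
    ∫ ω, a ω ∂μ ≤ p * ∫ ω, b ω ∂μ + q * ∫ ω, c ω ∂μ + r * ∫ ω, d ω ∂μ + s * ∫ ω, e ω ∂μ := by
  have hb' := hb.const_mul p
  have hc' := hc.const_mul q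
  have hd' := hd.const_mul r
  have he' := he.const_mul s
  have hbc : Integrable (fun ω => p * b ω + q * c ω) μ := hb'.add hc'
  have hbcd : Integrable (fun ω => p * b ω + q * c ω + r * d ω) μ := hbc.add hd'
  refine (integral_mono ha (hbcd.add he') h).trans_eq ?_
  simp only [Pi.add_apply]
  rw [integral_add hbcd he', integral_add hbc hd', integral_add hb' hc', integral_const_mul,
    integral_const_mul, integral_const_mul, integral_const_mul]

lemma integral_le_add_three (ha : Integrable a μ) (hb : Integrable b μ) (hc : Integrable c μ)
    (hd : Integrable d μ) (h : ∀ ω, a ω ≤ p * b ω + q * c ω + r * d ω) :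
    ∫ ω, a ω ∂μ ≤ p * ∫ ω, b ω ∂μ + q * ∫ ω, c ω ∂μ + r * ∫ ω, d ω ∂μ := by
  simpa using integral_le_add_four (s := 0) ha hb hc hd hd (by simpa using h)

lemma integral_le_add_two (ha : Integrable a μ) (hb : Integrable b μ) (hc : Integrable c μ)
    (h : ∀ ω, a ω ≤ p * b ω + q * c ω) :
    ∫ ω, a ω ∂μ ≤ p * ∫ ω, b ω ∂μ + q * ∫ ω, c ω ∂μ := by
  simpa using integral_le_add_three (r := 0) ha hb hc hc (by simpa using h)

end Integral

/-! ### Expected recursions and the general bound. -/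

section RunExpectation

variable {N : ℕ} {m n k : Fin N → ℕ} {Ω : Type v} [MeasurableSpace Ω] {Ξ : Type u}
  [MeasurableSpace Ξ] {μ : Measure Ω} [IsProbabilityMeasure μ] {𝒟 : Measure Ξ}
  [IsProbabilityMeasure 𝒟] {f : Params m n → ℝ} {F : Params m n → Ξ → ℝ} {L : ℝ}
  {σ : Fin N → ℝ} {ξ : ℕ → ℕ → Ω → Ξ}
  {topk : (ℓ : Fin N) → Matrix (Fin (m ℓ)) (Fin (n ℓ)) ℝ → Matrix (Fin (m ℓ)) (Fin (n ℓ)) ℝ}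
  {β η : ℝ} {τ B : ℕ} {x₀ : Params m n}

omit [IsProbabilityMeasure μ] [IsProbabilityMeasure 𝒟] in
lemma measurable_maskMul {S V : Ω → Params m n} (hS : Measurable S) (hV : Measurable V) :
    Measurable fun ω => maskMul (S ω) (V ω) :=
  measurable_params fun ℓ i j =>
    (measurable_blocks_apply hS ℓ i j).mul (measurable_blocks_apply hV ℓ i j)

omit [IsProbabilityMeasure μ] in
lemma memLp_maskMul {S V : Ω → Params m n} (hS : Measurable S) (hSm : ∀ ω, IsMask (S ω))
    (hVm : Measurable V) (hV : MemLp V 2 μ) : MemLp (fun ω => maskMul (S ω) (V ω)) 2 μ :=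
  hV.of_le (measurable_maskMul hS hVm).aestronglyMeasurable
    (Filter.Eventually.of_forall fun ω => (hSm ω).norm_maskMul_le _)

lemma IsSmooth.norm_gradient_le (hf : IsSmooth L f) (x : Params m n) :
    ‖gradient f x‖ ≤ ‖gradient f 0‖ + ‖L • x‖ := by
  have h1 := hf.2 x 0
  have h2 := norm_sub_norm_le (gradient f x) (gradient f 0)
  rw [sub_zero] at h1
  rw [norm_smul]
  have h3 : L * ‖x‖ ≤ ‖L‖ * ‖x‖ := by gcongr; exact Real.le_norm_self L
  linarith

lemma memLp_gradient_comp (hf : IsSmooth L f) {X : Ω → Params m n} (hXm : Measurable X)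
    (hX : MemLp X 2 μ) : MemLp (fun ω => gradient f (X ω)) 2 μ := by
  have hc : ∀ c : ℝ, MemLp (fun ω => c + ‖L • X ω‖) 2 μ := fun c =>
    (memLp_const c).add (hX.const_smul L).norm
  have hgrad : Measurable (gradient f) := hf.continuous_gradient.measurable
  have hm : Measurable fun ω => gradient f (X ω) := by fun_prop
  refine (hc ‖gradient f 0‖).of_le hm.aestronglyMeasurable ?_
  filter_upwards with ω
  exact (hf.norm_gradient_le (X ω)).trans (Real.le_norm_self _)

omit [MeasurableSpace Ω] [IsProbabilityMeasure 𝒟] in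
lemma measurable_iterate_past (hF : IsGradientOracle f F 𝒟 σ)
    (htop : ∀ ℓ, IsTopKRule (k ℓ) (topk ℓ)) (t : ℕ) :
    Measurable[sampleAlg ξ {p | p.1 < t}] (iterate F topk β η τ B x₀ ξ t) :=
  (@measurable_run _ _ _ _ _ (sampleAlg ξ {p | p.1 < t}) _ _ _ _ β η τ B x₀ ξ hF.measurable
    htop t fun _ hs _ => measurable_sampleAlg hs).1

omit [MeasurableSpace Ω] [IsProbabilityMeasure 𝒟] in
lemma measurable_runMask_past (hF : IsGradientOracle f F 𝒟 σ)
    (htop : ∀ ℓ, IsTopKRule (k ℓ) (topk ℓ)) (t : ℕ) :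
    Measurable[sampleAlg ξ {p | p.1 < t + 1}] (runMask F topk β η τ B x₀ ξ t) :=
  @measurable_params _ _ _ _ (sampleAlg ξ {p | p.1 < t + 1}) _
    (@measurable_run _ _ _ _ _ (sampleAlg ξ {p | p.1 < t + 1}) _ _ _ _ β η τ B x₀ ξ hF.measurable
    htop (t + 1) fun _ hs _ => measurable_sampleAlg hs).2.1

omit [MeasurableSpace Ω] [IsProbabilityMeasure 𝒟] in
lemma measurable_runMomentum_past (hF : IsGradientOracle f F 𝒟 σ)
    (htop : ∀ ℓ, IsTopKRule (k ℓ) (topk ℓ)) (t : ℕ) :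
    Measurable[sampleAlg ξ {p | p.1 < t + 1}] (runMomentum F topk β η τ B x₀ ξ t) :=
  @measurable_params _ _ _ _ (sampleAlg ξ {p | p.1 < t + 1}) _
    (@measurable_run _ _ _ _ _ (sampleAlg ξ {p | p.1 < t + 1}) _ _ _ _ β η τ B x₀ ξ hF.measurable
    htop (t + 1) fun _ hs _ => measurable_sampleAlg hs).2.2

omit [MeasurableSpace Ω] [MeasurableSpace Ξ] in
lemma runGrad_of_dvd (hB : 1 ≤ B) {t : ℕ} (h : τ ∣ t) (ω : Ω) :
    runGrad F topk β η τ B x₀ ξ t ω - gradient f (iterate F topk β η τ B x₀ ξ t ω)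
      = (1 / (B : ℝ)) • ∑ b ∈ Finset.range B,
        gradNoise f F (iterate F topk β η τ B x₀ ξ t ω) (ξ t b ω) := by
  have hB' : (B : ℝ) ≠ 0 := by positivity
  have e : runGrad F topk β η τ B x₀ ξ t ω = (1 / (B : ℝ)) • ∑ b ∈ Finset.range B,
      stochGrad F (iterate F topk β η τ B x₀ ξ t ω) (ξ t b ω) := by
    ext ⟨ℓ, i, j⟩
    simp [runGrad, gradEst, assemble, h, blocks, Matrix.sum_apply]
  rw [e]
  simp only [gradNoise, Finset.sum_sub_distrib, Finset.sum_const, Finset.card_range, smul_sub,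
    ← Nat.cast_smul_eq_nsmul ℝ, smul_smul]
  rw [one_div_mul_cancel hB', one_smul]

omit [MeasurableSpace Ω] [MeasurableSpace Ξ] in
lemma runGrad_of_not_dvd {t : ℕ} (h : ¬ τ ∣ t) (ω : Ω) :
    runGrad F topk β η τ B x₀ ξ t ω - gradient f (iterate F topk β η τ B x₀ ξ t ω)
      = gradNoise f F (iterate F topk β η τ B x₀ ξ t ω) (ξ t 0 ω) := by
  rw [gradNoise]
  congr 1
  ext ⟨ℓ, i, j⟩
  simp [runGrad, gradEst, assemble, h, blocks]

/-- Moments of the error of the gradient estimate. -/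
lemma runGrad_error (hf : IsSmooth L f) (hF : IsGradientOracle f F 𝒟 σ)
    (hξ : IsSampleStream μ 𝒟 ξ) (htop : ∀ ℓ, IsTopKRule (k ℓ) (topk ℓ)) (hB : 1 ≤ B) (t : ℕ) :
    MemLp (fun ω => runGrad F topk β η τ B x₀ ξ t ω
        - gradient f (iterate F topk β η τ B x₀ ξ t ω)) 2 μ ∧
      ∫ ω, ‖runGrad F topk β η τ B x₀ ξ t ω
        - gradient f (iterate F topk β η τ B x₀ ξ t ω)‖ ^ 2 ∂μ
        ≤ if τ ∣ t then totalSigma σ ^ 2 / B else totalSigma σ ^ 2 := by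
  have hX := measurable_iterate_past (ξ := ξ) (β := β) (η := η) (τ := τ) (B := B) (x₀ := x₀)
    hF htop t
  have hp : ∀ b, (t, b) ∉ {p : ℕ × ℕ | p.1 < t} := fun b => by simp
  by_cases h : τ ∣ t
  · simp only [runGrad_of_dvd hB h, if_pos h]
    obtain ⟨h1, h2⟩ := batch_gradNoise hf hF hξ hX hp B
    refine ⟨h1.const_smul (1 / (B : ℝ)), ?_⟩
    have hB' : (0 : ℝ) < B := by positivity
    simp only [norm_smul, mul_pow]
    rw [integral_const_mul, Real.norm_of_nonneg (by positivity), le_div_iff₀ hB']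
    calc _ ≤ (1 / (B : ℝ)) ^ 2 * (B * totalSigma σ ^ 2) * B := by gcongr
      _ = _ := by field_simp
  · simp only [runGrad_of_not_dvd h, if_neg h]
    exact ⟨memLp_gradNoise hf hF hξ hX (hp 0), (integrable_and_integral_norm_sq_gradNoise_sample hf hF hξ hX (hp 0)).2⟩

/-- Square integrability propagates jointly: gradients grow at most linearly, the noise has finite
variance and masks do not increase norms. -/
lemma memLp_iterate_runMomentum (hf : IsSmooth L f) (hF : IsGradientOracle f F 𝒟 σ)
    (hξ : IsSampleStream μ 𝒟 ξ) (htop : ∀ ℓ, IsTopKRule (k ℓ) (topk ℓ)) (hB : 1 ≤ B) (t : ℕ) :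
    MemLp (iterate F topk β η τ B x₀ ξ t) 2 μ ∧ MemLp (runMomentum F topk β η τ B x₀ ξ t) 2 μ := by
  have hxm : ∀ t, Measurable (iterate F topk β η τ B x₀ ξ t) := fun t =>
    (measurable_iterate_past hF htop t).mono (hξ.sampleAlg_le _) le_rfl
  have hSm : ∀ t, Measurable (runMask F topk β η τ B x₀ ξ t) := fun t =>
    (measurable_runMask_past hF htop t).mono (hξ.sampleAlg_le _) le_rfl
  have hMm : ∀ t, Measurable (runMomentum F topk β η τ B x₀ ξ t) := fun t =>
    (measurable_runMomentum_past hF htop t).mono (hξ.sampleAlg_le _) le_rfl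
  -- Here V stands for the previous momentum; taking V = 0 covers the first iteration.
  have hmom : ∀ t, MemLp (iterate F topk β η τ B x₀ ξ t) 2 μ → ∀ V : Ω → Params m n,
      MemLp V 2 μ → (∀ ω, runMomentum F topk β η τ B x₀ ξ t ω
        = maskMul (runMask F topk β η τ B x₀ ξ t ω)
          ((1 - β) • V ω + β • runGrad F topk β η τ B x₀ ξ t ω)) →
      MemLp (runMomentum F topk β η τ B x₀ ξ t) 2 μ := by
    intro t hx V hV he
    have hG : MemLp (runGrad F topk β η τ B x₀ ξ t) 2 μ := by
      have h1 := (runGrad_error (β := β) (η := η) (τ := τ) (x₀ := x₀) hf hF hξ htop hB t).1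
      refine (h1.add (memLp_gradient_comp hf (hxm t) hx)).ae_eq
        (Filter.Eventually.of_forall fun ω => ?_)
      simp
    have h : MemLp (fun ω => (1 - β) • V ω + β • runGrad F topk β η τ B x₀ ξ t ω) 2 μ :=
      (hV.const_smul (1 - β)).add (hG.const_smul β)
    exact h.of_le (hMm t).aestronglyMeasurable (Filter.Eventually.of_forall fun ω => by
      rw [he]; exact (isMask_runMask htop t).norm_maskMul_le _)
  induction t with
  | zero =>
    have hx : MemLp (iterate F topk β η τ B x₀ ξ 0) 2 μ := memLp_const x₀
    refine ⟨hx, hmom 0 hx (fun _ => 0) (memLp_const 0) fun ω => ?_⟩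
    rw [runMomentum_zero, smul_zero, zero_add]
  | succ t ih =>
    have hx : MemLp (iterate F topk β η τ B x₀ ξ (t + 1)) 2 μ := by
      have h := ih.1.sub (ih.2.const_smul η)
      refine h.ae_eq (Filter.Eventually.of_forall fun ω => ?_)
      simp [iterate_succ, maskMul_runMomentum htop]
    exact ⟨hx, hmom (t + 1) hx _ ih.2 fun ω => runMomentum_succ⟩

/-- Convergence for general hyperparameters. -/
theorem avgSqGradLE_run (hN : 0 < N) (hk : ∀ ℓ, 1 ≤ k ℓ ∧ k ℓ ≤ m ℓ * n ℓ)
    (hbdd : BddBelow (Set.range f)) (hL : 0 < L) (hf : IsSmooth L f)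
    (hF : IsGradientOracle f F 𝒟 σ) (hξ : IsSampleStream μ 𝒟 ξ)
    (htop : ∀ ℓ, IsTopKRule (k ℓ) (topk ℓ)) {δ s Δ : ℝ} (hδ : δ = minDensity m n k)
    (hs : s = totalSigma σ) (hΔ : Δ = gap f x₀) (hβ0 : 0 < β) (hβ1 : β ≤ 1)
    (hτ : 64 / (3 * β * δ) ≤ (τ : ℝ)) (hη : 0 < η) (hη1 : η ≤ 1 / (4 * L))
    (hη2 : η ≤ √(3 * δ * β ^ 2 / (80 * L ^ 2))) (hη3 : η ≤ √(δ / (40 * (τ : ℝ) ^ 2 * L ^ 2)))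
    (hB : 1 ≤ B) {K : ℕ} (hK : 1 ≤ K) :
    AvgSqGradLE μ f (iterate F topk β η τ B x₀ ξ) (K * τ)
      (16 * Δ / (δ * η * K * τ)
        + (160 / (3 * β * δ * τ * B) + 352 / (3 * δ ^ 2 * B) + 32 * β / (3 * δ)) * s ^ 2) := by
  have hδ0 : 0 < δ := hδ ▸ minDensity_pos hN hk
  have hδ1 : δ ≤ 1 := hδ ▸ minDensity_le_one hN hk
  have hτ0 : (0 : ℝ) < τ := lt_of_lt_of_le (by positivity) hτ
  have hτn : 0 < τ := by exact_mod_cast hτ0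
  have hB0 : (0 : ℝ) < B := by positivity
  have hK0 : (0 : ℝ) < K := by positivity
  set x := iterate F topk β η τ B x₀ ξ with hx
  set S := runMask F topk β η τ B x₀ ξ with hSdef
  set M := runMomentum F topk β η τ B x₀ ξ with hMdef
  set G := runGrad F topk β η τ B x₀ ξ with hGdef
  let g : ℕ → Ω → Params m n := fun t ω => gradient f (x t ω)
  let z : ℕ → Ω → Params m n := fun t ω => G t ω - g t ω
  have hSmask : ∀ t ω, IsMask (S t ω) := fun t ω => isMask_runMask htop t
  have hSM : ∀ t ω, maskMul (S t ω) (M t ω) = M t ω := fun t ω => maskMul_runMomentum htop t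
  have hxsucc : ∀ t ω, x (t + 1) ω = x t ω - η • M t ω := fun t ω => by
    rw [hx, iterate_succ, maskMul_runMomentum htop]
  have hGz : ∀ t ω, G t ω = g t ω + z t ω := fun t ω => by simp only [z]; abel
  have hlip : ∀ t t' ω, ‖g t ω - g t' ω‖ ^ 2 ≤ L ^ 2 * ‖x t ω - x t' ω‖ ^ 2 := fun t t' ω => by
    rw [← mul_pow]
    gcongr
    exact hf.2 _ _
  -- measurability and square integrability
  have hxp : ∀ t, Measurable[sampleAlg ξ {p | p.1 < t}] (x t) := measurable_iterate_past hF htop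
  have hSp : ∀ t, Measurable[sampleAlg ξ {p | p.1 < t + 1}] (S t) :=
    measurable_runMask_past hF htop
  have hMp : ∀ t, Measurable[sampleAlg ξ {p | p.1 < t + 1}] (M t) :=
    measurable_runMomentum_past hF htop
  have hxm : ∀ t, Measurable (x t) := fun t => (hxp t).mono (hξ.sampleAlg_le _) le_rfl
  have hSm : ∀ t, Measurable (S t) := fun t => (hSp t).mono (hξ.sampleAlg_le _) le_rfl
  have hgrad : Measurable (gradient f) := hf.continuous_gradient.measurable
  have hgm : ∀ t, Measurable (g t) := fun t => hgrad.comp (hxm t)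
  have hx2 : ∀ t, MemLp (x t) 2 μ := fun t => (memLp_iterate_runMomentum hf hF hξ htop hB t).1
  have hM2 : ∀ t, MemLp (M t) 2 μ := fun t => (memLp_iterate_runMomentum hf hF hξ htop hB t).2
  have hg2 : ∀ t, MemLp (g t) 2 μ := fun t => memLp_gradient_comp hf (hxm t) (hx2 t)
  have hz2 : ∀ t, MemLp (z t) 2 μ := fun t => (runGrad_error hf hF hξ htop hB t).1
  have hSg2 : ∀ t t', MemLp (fun ω => maskMul (S t ω) (g t' ω)) 2 μ := fun t t' =>
    memLp_maskMul (hSm t) (hSmask t) (hgm t') (hg2 t')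
  have iA : ∀ t, Integrable (fun ω => ‖g t ω‖ ^ 2) μ := fun t =>
    (hg2 t).integrable_norm_pow two_ne_zero
  have iP : ∀ t, Integrable (fun ω => ‖maskMul (S t ω) (g t ω)‖ ^ 2) μ := fun t =>
    (hSg2 t t).integrable_norm_pow two_ne_zero
  have iD : ∀ t t', Integrable (fun ω => ‖x t ω - x t' ω‖ ^ 2) μ := fun t t' =>
    ((hx2 t).sub (hx2 t')).integrable_norm_pow two_ne_zero
  have iE : ∀ t, Integrable (fun ω => ‖M t ω - maskMul (S t ω) (g t ω)‖ ^ 2) μ := fun t =>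
    ((hM2 t).sub (hSg2 t t)).integrable_norm_pow two_ne_zero
  have iZ : ∀ t, Integrable (fun ω => ‖z t ω‖ ^ 2) μ := fun t =>
    (hz2 t).integrable_norm_pow two_ne_zero
  have hZ : ∀ t, ∫ ω, ‖z t ω‖ ^ 2 ∂μ ≤ if τ ∣ t then s ^ 2 / B else s ^ 2 := fun t => by
    rw [hs]; exact (runGrad_error hf hF hξ htop hB t).2
  have hdiv : ∀ r j, j < τ → (r * τ + j) / τ * τ = r * τ := fun r j hj => by
    rw [Nat.add_comm, Nat.add_mul_div_right _ _ hτn, Nat.div_eq_of_lt hj, zero_add]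
  -- In `Q`, the index t / τ * τ is the start of the period containing t, where the current mask was
  -- computed.
  have main := sum_le_of_recursions (K := K) (Δ := Δ) (s := s) (V := s ^ 2 / B)
    (A := fun t => ∫ ω, ‖g t ω‖ ^ 2 ∂μ)
    (P := fun t => ∫ ω, ‖maskMul (S t ω) (g t ω)‖ ^ 2 ∂μ)
    (D := fun t => ∫ ω, ‖x (t + 1) ω - x t ω‖ ^ 2 ∂μ)
    (E := fun t => ∫ ω, ‖M t ω - maskMul (S t ω) (g t ω)‖ ^ 2 ∂μ)
    (Q := fun t => ∫ ω, ‖x t ω - x (t / τ * τ) ω‖ ^ 2 ∂μ)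
    hL hδ0 hδ1 hβ0 hβ1 hτ hη hη1 hη2 hη3
    (fun t => integral_nonneg fun _ => sq_nonneg _) (fun t => integral_nonneg fun _ => sq_nonneg _)
    (fun t => integral_nonneg fun _ => sq_nonneg _) (fun t => integral_nonneg fun _ => sq_nonneg _)
    ?descent ?init ?track ?base ?retain ?drift
  case descent =>
    have hpt : ∀ ω, ∑ t ∈ Finset.range (K * τ), (η / 2 * ‖maskMul (S t ω) (g t ω)‖ ^ 2
        + (1 / (2 * η) - L / 2) * ‖x (t + 1) ω - x t ω‖ ^ 2
        - η / 2 * ‖M t ω - maskMul (S t ω) (g t ω)‖ ^ 2) ≤ Δ := by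
      intro ω
      have h1 : ∀ t ∈ Finset.range (K * τ), η / 2 * ‖maskMul (S t ω) (g t ω)‖ ^ 2
          + (1 / (2 * η) - L / 2) * ‖x (t + 1) ω - x t ω‖ ^ 2
          - η / 2 * ‖M t ω - maskMul (S t ω) (g t ω)‖ ^ 2 ≤ f (x t ω) - f (x (t + 1) ω) := by
        intro t _
        rw [hxsucc]
        exact descent_of_maskMul (hSM t ω) hf.1 hf.2 hη
      refine (Finset.sum_le_sum h1).trans ?_
      rw [Finset.sum_range_sub' (fun t => f (x t ω)), hΔ, gap]
      have h2 : ⨅ y, f y ≤ f (x (K * τ) ω) := ciInf_le hbdd _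
      have h3 : x 0 ω = x₀ := rfl
      rw [h3]
      linarith
    have iT : ∀ t ∈ Finset.range (K * τ),
        Integrable (fun ω => η / 2 * ‖maskMul (S t ω) (g t ω)‖ ^ 2
        + (1 / (2 * η) - L / 2) * ‖x (t + 1) ω - x t ω‖ ^ 2
        - η / 2 * ‖M t ω - maskMul (S t ω) (g t ω)‖ ^ 2) μ := fun t _ =>
      (((iP t).const_mul _).add ((iD (t + 1) t).const_mul _)).sub ((iE t).const_mul _)
    have h := integral_mono (integrable_finsetSum _ iT) (integrable_const Δ) hpt
    rw [integral_finsetSum _ iT] at h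
    simp only [integral_const, probReal_univ, smul_eq_mul, one_mul] at h
    refine le_trans (le_of_eq (Finset.sum_congr rfl fun t _ => ?_)) h
    have iPD : Integrable (fun ω => η / 2 * ‖maskMul (S t ω) (g t ω)‖ ^ 2
        + (1 / (2 * η) - L / 2) * ‖x (t + 1) ω - x t ω‖ ^ 2) μ :=
      ((iP t).const_mul _).add ((iD (t + 1) t).const_mul _)
    rw [integral_sub iPD ((iE t).const_mul _),
      integral_add ((iP t).const_mul _) ((iD (t + 1) t).const_mul _), integral_const_mul,
      integral_const_mul, integral_const_mul]
  case init =>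
    have h := integral_le_add_two (p := 1) (q := β) (iE 0) (iA 0) (iZ 0) fun ω => by
      have e : M 0 ω = maskMul (S 0 ω) (β • (g 0 ω + z 0 ω)) := by
        rw [← hGz]; exact runMomentum_zero
      rw [e, one_mul]
      exact (hSmask 0 ω).momentum_error_init hβ0 hβ1
    have hz := hZ 0
    rw [if_pos (dvd_zero τ)] at hz
    have := mul_le_mul_of_nonneg_left hz hβ0.le
    linarith
  case track =>
    intro t
    have e : ∀ ω, M (t + 1) ω = maskMul (S (t + 1) ω)
        ((1 - β) • M t ω + β • (g (t + 1) ω + z (t + 1) ω)) := fun ω => by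
      rw [← hGz]; exact runMomentum_succ
    have hl : ∀ ω, 2 / β * ‖g (t + 1) ω - g t ω‖ ^ 2
        ≤ 2 / β * L ^ 2 * ‖x (t + 1) ω - x t ω‖ ^ 2 := fun ω => by
      rw [mul_assoc]; gcongr; exact hlip _ _ ω
    have hz := hZ (t + 1)
    by_cases hd : τ ∣ t + 1
    · rw [if_pos hd] at hz ⊢
      -- The new mask is a function of the batch noise, so no cross term can be discarded: the noise
      -- is weighted by β instead of β², and the variance is that of the batch.
      have h := integral_le_add_four (p := 1 - β / 2) (q := 2 / β * L ^ 2) (r := 1) (s := β)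
        (iE (t + 1)) (iE t) (iD (t + 1) t) (iA (t + 1)) (iZ (t + 1)) fun ω => by
          rw [e]
          have := (hSmask t ω).momentum_error_change (g := g t ω) (g' := g (t + 1) ω)
            (n := z (t + 1) ω) (hSmask (t + 1) ω) (hSM t ω) hβ0 hβ1
          linarith [hl ω]
      have := mul_le_mul_of_nonneg_left hz hβ0.le
      linarith
    · rw [if_neg hd] at hz ⊢
      -- The factor paired with the fresh noise. As the mask is kept, U involves only x_{t+1}, S_t
      -- and M_t, hence only samples of iterations up to t.
      let U : Ω → Params m n := fun ω =>
        (2 * (1 - β) * β) • (M t ω - maskMul (S t ω) (g (t + 1) ω))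
      have hSs : ∀ ω, S (t + 1) ω = S t ω := fun ω => runMask_succ hd
      have hU2 : MemLp U 2 μ := ((hM2 t).sub (hSg2 t (t + 1))).const_smul (2 * (1 - β) * β)
      have hUm : Measurable[sampleAlg ξ {p | p.1 < t + 1}] U := by
        have h1 : Measurable[sampleAlg ξ {p | p.1 < t + 1}] (g (t + 1)) :=
          hgrad.comp (hxp (t + 1))
        have h2 := @measurable_maskMul _ _ _ _ (sampleAlg ξ {p | p.1 < t + 1}) _ _ (hSp t) h1
        exact ((hMp t).sub h2).const_smul (2 * (1 - β) * β)
      have h0 : ∫ ω, inner ℝ (U ω) (z (t + 1) ω) ∂μ = 0 := by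
        have h1 := integral_inner_gradNoise_sample (b := 0) (t := t + 1) hf hF hξ (hxp (t + 1)) hUm
          hU2 (by simp)
        rw [← h1]
        refine integral_congr_ae (Filter.Eventually.of_forall fun ω => ?_)
        simp only [z, g, hx, hGdef, runGrad_of_not_dvd hd]
      have h := integral_le_add_four (p := 1 - β / 2) (q := 2 / β * L ^ 2) (r := β ^ 2) (s := 1)
        (iE (t + 1)) (iE t) (iD (t + 1) t) (iZ (t + 1))
        (hU2.integrable_inner_of_two (hz2 (t + 1))) fun ω => by
          rw [e, hSs]
          have := (hSmask t ω).momentum_error_keep (g := g t ω) (g' := g (t + 1) ω)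
            (n := z (t + 1) ω) (hSM t ω) hβ0 hβ1
          simp only [U]
          linarith [hl ω]
      rw [h0] at h
      have := mul_le_mul_of_nonneg_left hz (sq_nonneg β)
      linarith
  case base =>
    intro r j hj
    have h := integral_le_add_two (p := 3 / 2) (q := 3 * L ^ 2) (iA (r * τ + j)) (iA (r * τ))
      (iD (r * τ + j) (r * τ)) fun ω => by
        have h1 := norm_add_sq_le_weighted (g (r * τ) ω) (g (r * τ + j) ω - g (r * τ) ω)
          (c := 1 / 2) (by norm_num)
        rw [add_sub_cancel] at h1
        linarith [hlip (r * τ + j) (r * τ) ω]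
    simp only [hdiv r j hj]
    linarith
  case retain =>
    intro r j hj
    have hd : τ ∣ r * τ := Dvd.intro_left r rfl
    have h := integral_le_add_three (p := 9 / 4) (q := 9 / 2 * L ^ 2) (r := 12)
      ((iA (r * τ)).const_mul δ) (iP (r * τ + j)) (iD (r * τ + j) (r * τ)) (iZ (r * τ))
      fun ω => by
        have h1 := (hSmask (r * τ) ω).retained_le (g := g (r * τ) ω) (n := z (r * τ) ω)
          hδ0.le hδ1 (by
            rw [← hGz, hδ]
            exact minDensity_mul_le hk htop hd)
        have hSj : S (r * τ + j) ω = S (r * τ) ω := runMask_eq_of_lt r hj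
        -- Passing from g at the start of the period to the current g with weight 1/2 turns the 3/2
        -- of `h1` into 9/4 and adds 3/2 · 3 = 9/2 times the squared gradient drift.
        have h2 := norm_add_sq_le_weighted (maskMul (S (r * τ) ω) (g (r * τ + j) ω))
          (maskMul (S (r * τ) ω) (g (r * τ) ω - g (r * τ + j) ω)) (c := 1 / 2) (by norm_num)
        rw [← map_add, add_sub_cancel] at h2
        have h3 := (hSmask (r * τ) ω).norm_maskMul_sq_le (g (r * τ) ω - g (r * τ + j) ω)
        rw [norm_sub_rev] at h3
        have h4 := hlip (r * τ + j) (r * τ) ω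
        rw [hSj]
        have h5 : ‖g (r * τ) ω - g (r * τ + j) ω‖ = ‖g (r * τ + j) ω - g (r * τ) ω‖ :=
          norm_sub_rev _ _
        linarith
    rw [integral_const_mul] at h
    have hz := hZ (r * τ)
    rw [if_pos hd] at hz
    simp only [hdiv r j hj]
    linarith
  case drift =>
    intro r j hj
    simp only [hdiv r j hj]
    have i1 : ∀ i ∈ Finset.range τ,
        Integrable (fun ω => ‖x (r * τ + i + 1) ω - x (r * τ + i) ω‖ ^ 2) μ := fun i _ => iD _ _
    rw [← integral_finsetSum _ i1, ← integral_const_mul]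
    exact integral_mono (iD _ _) ((integrable_finsetSum _ i1).const_mul _) fun ω =>
      norm_sub_sq_le_sum (fun t => x t ω) (r * τ) hj.le
  refine ⟨fun t _ => iA t, ?_⟩
  push_cast
  have hV : 0 ≤ s ^ 2 / B := by positivity
  rw [one_div, inv_mul_le_iff₀ (by positivity)]
  refine main.trans ?_
  have e1 : (K : ℝ) * τ * (16 * Δ / (δ * η * K * τ)
      + (160 / (3 * β * δ * τ * B) + 352 / (3 * δ ^ 2 * B) + 32 * β / (3 * δ)) * s ^ 2)
      = 1 / δ * (16 * Δ / η + 160 / 3 * (1 / β) * K * (s ^ 2 / B)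
        + 352 / 3 * (1 / δ) * (K * τ) * (s ^ 2 / B) + 32 / 3 * β * (K * τ) * s ^ 2) := by
    field_simp
    ring
  have hΔ0 : 0 ≤ Δ := by
    rw [hΔ, gap]; linarith [ciInf_le hbdd x₀]
  have hβi : 1 ≤ 1 / β := by rwa [le_div_iff₀ hβ0, one_mul]
  have hδi : 1 ≤ 1 / δ := by rwa [le_div_iff₀ hδ0, one_mul]
  rw [e1]
  -- The bound in `main` is sharper than the claimed one; it is loosened using 1/β ≥ 1 and 1/δ ≥ 1.
  have c1 : 32 / 3 * Δ / η ≤ 16 * Δ / η := by gcongr; norm_num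
  have c2 : 32 / 3 * K * (s ^ 2 / B) ≤ 160 / 3 * (1 / β) * K * (s ^ 2 / B) := by
    gcongr; linarith
  have c3 : 24 * (K * τ) * (s ^ 2 / B) ≤ 352 / 3 * (1 / δ) * (K * τ) * (s ^ 2 / B) := by
    gcongr; linarith
  gcongr 1 / δ * ?_
  linarith

end RunExpectation

/-! ### Arithmetic of the specific hyperparameters. -/

section Choices

variable {L Δ s δ ε β η : ℝ} {τ B T : ℕ}

lemma rpow_half_odd (hδ : 0 < δ) (j : ℕ) : δ ^ ((j : ℝ) / 2) = √δ ^ j := by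
  rw [Real.sqrt_eq_rpow, ← Real.rpow_natCast, ← Real.rpow_mul hδ.le]
  congr 1
  ring

lemma betaChoice_eq (hδ : 0 < δ) :
    betaChoice L Δ s δ T = (1 + √(√δ ^ 3 * s ^ 2 * T / (L * Δ)))⁻¹ := by
  rw [betaChoice, ← rpow_half_odd hδ]
  norm_num

lemma betaChoice_pos : 0 < betaChoice L Δ s δ T := by
  rw [betaChoice]; positivity

lemma betaChoice_le_one : betaChoice L Δ s δ T ≤ 1 := by
  rw [betaChoice]
  exact inv_le_one_of_one_le₀ (le_add_of_nonneg_right (Real.sqrt_nonneg _))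

lemma le_tauChoice : 64 / (3 * β * δ) ≤ (tauChoice δ β : ℝ) := by
  rw [tauChoice, mul_right_comm 3 β δ]
  exact Nat.le_ceil _

lemma batchChoice_le_tauChoice (hδ : 0 < δ) (hβ : 0 < β) : batchChoice δ β ≤ tauChoice δ β := by
  refine Nat.ceil_mono ?_
  rw [div_le_div_iff₀ (by positivity) (by positivity)]
  nlinarith [mul_pos hδ hβ]

lemma one_le_batchChoice (hδ : 0 < δ) (hβ : 0 < β) : 1 ≤ batchChoice δ β :=
  Nat.one_le_iff_ne_zero.2 (Nat.ceil_pos.2 (by positivity)).ne'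

/-- With 1/β = 1 + u, the threshold is 64/(3δ) + 64u/(3δ). Each summand is at most T/2: the first by
the term 128/(3δ) of `minIterations`, the second because its square is T/4 times the last term
there. -/
lemma tauChoice_le (hδ : 0 < δ) (hL : 0 < L) (hΔ : 0 < Δ)
    (hT : minIterations L Δ s δ ≤ T) : tauChoice δ (betaChoice L Δ s δ T) ≤ T := by
  rw [tauChoice, Nat.ceil_le, betaChoice_eq hδ]
  have hw : 0 < √δ := Real.sqrt_pos.2 hδ
  have hδw : δ = √δ ^ 2 := (Real.sq_sqrt hδ.le).symm
  have hT0 : (0 : ℝ) ≤ T := T.cast_nonneg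
  rw [minIterations] at hT
  set w := √δ with hwdef
  set u := √(w ^ 3 * s ^ 2 * T / (L * Δ)) with hu
  have hp1 : 0 ≤ 128 / (3 * δ) := by positivity
  have hp2 : 0 ≤ (128 * s) ^ 2 / (9 * w * L * Δ) := by positivity
  have h1 : 64 / (3 * δ) * u ≤ T / 2 := by
    have : 64 / (3 * δ) * u = √((64 / (3 * δ)) ^ 2 * (w ^ 3 * s ^ 2 * T / (L * Δ))) := by
      rw [Real.sqrt_mul (by positivity), Real.sqrt_sq (by positivity)]
    rw [this, Real.sqrt_le_left (by positivity)]
    have e : (64 / (3 * δ)) ^ 2 * (w ^ 3 * s ^ 2 * T / (L * Δ))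
        = (128 * s) ^ 2 / (9 * w * L * Δ) * T / 4 := by
      rw [hδw]; field_simp; ring
    rw [e]
    have : (128 * s) ^ 2 / (9 * w * L * Δ) ≤ T := by linarith
    nlinarith
  have e : 64 / (3 * δ * (1 + u)⁻¹) = 64 / (3 * δ) + 64 / (3 * δ) * u := by
    field_simp
  have e2 : 128 / (3 * δ) = 2 * (64 / (3 * δ)) := by ring
  rw [e]
  linarith

lemma etaChoice_pos (hL : 0 < L) : 0 < etaChoice L δ β τ := by
  rw [etaChoice]; positivity

lemma etaChoice_le (hL : 0 < L) : etaChoice L δ β τ ≤ 1 / (4 * L) ∧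
    (0 < δ → 0 < β → etaChoice L δ β τ ≤ √(3 * δ * β ^ 2 / (80 * L ^ 2))) ∧
    (0 < δ → 0 < τ → etaChoice L δ β τ ≤ √(δ / (40 * (τ : ℝ) ^ 2 * L ^ 2))) := by
  have h1 := Real.sqrt_nonneg (80 * L ^ 2 / (3 * δ * β ^ 2))
  have h2 := Real.sqrt_nonneg (40 * (τ : ℝ) ^ 2 * L ^ 2 / δ)
  have h3 := Real.sqrt_nonneg (32 * (τ : ℝ) * L ^ 2 / (3 * β))
  rw [etaChoice]
  refine ⟨?_, fun hδ hβ => ?_, fun hδ hτ => ?_⟩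
  · rw [one_div]
    gcongr
    linarith
  · have e : √(3 * δ * β ^ 2 / (80 * L ^ 2)) = (√(80 * L ^ 2 / (3 * δ * β ^ 2)))⁻¹ := by
      rw [← Real.sqrt_inv, inv_div]
    rw [e]
    have : 0 < √(80 * L ^ 2 / (3 * δ * β ^ 2)) := Real.sqrt_pos.2 (by positivity)
    exact inv_anti₀ this (by linarith)
  · have e : √(δ / (40 * (τ : ℝ) ^ 2 * L ^ 2)) = (√(40 * (τ : ℝ) ^ 2 * L ^ 2 / δ))⁻¹ := by
      rw [← Real.sqrt_inv, inv_div]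
    rw [e]
    have : 0 < √(40 * (τ : ℝ) ^ 2 * L ^ 2 / δ) := Real.sqrt_pos.2 (by positivity)
    exact inv_anti₀ this (by linarith)

/-- All four summands are multiples of L/(√δ³β) at most, the one with τL/√δ being of exactly this
order. The rounding gives τ ≤ 23/(δβ), and 187 = 4 + 6 + 7 · 23 + 16. -/
lemma inv_etaChoice_le (hL : 0 < L) (hδ0 : 0 < δ) (hδ1 : δ ≤ 1) (hβ0 : 0 < β) (hβ1 : β ≤ 1) :
    (etaChoice L δ β (tauChoice δ β))⁻¹ ≤ 187 * (L / (√δ ^ 3 * β)) := by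
  have hw : 0 < √δ := Real.sqrt_pos.2 hδ0
  have hw1 : √δ ≤ 1 := Real.sqrt_le_one.2 hδ1
  have hδw : δ = √δ ^ 2 := (Real.sq_sqrt hδ0.le).symm
  have hτ : (tauChoice δ β : ℝ) ≤ 23 / (δ * β) := by
    refine (Nat.ceil_lt_add_one (by positivity)).le.trans ?_
    have : 1 ≤ 1 / (δ * β) := by
      rw [le_div_iff₀ (by positivity), one_mul]
      exact mul_le_one₀ hδ1 hβ0.le hβ1
    have e : 64 / (3 * δ * β) = 64 / 3 * (1 / (δ * β)) := by field_simp
    have e' : 23 / (δ * β) = 23 * (1 / (δ * β)) := by ring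
    rw [e, e']
    linarith
  rw [etaChoice, inv_inv]
  set t : ℝ := (tauChoice δ β : ℝ) with ht
  have ht0 : 0 ≤ t := Nat.cast_nonneg _
  set w := √δ with hwdef
  have hwβ : L ≤ L / (w ^ 3 * β) := by
    rw [le_div_iff₀ (by positivity)]
    exact mul_le_of_le_one_right hL.le (mul_le_one₀ (pow_le_one₀ hw.le hw1) hβ0.le hβ1)
  have hww : L / (w * β) ≤ L / (w ^ 3 * β) := by
    have : w ^ 3 ≤ w := by
      simpa using pow_le_pow_of_le_one hw.le hw1 (show 1 ≤ 3 by norm_num)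
    gcongr
  have c2 : √(80 * L ^ 2 / (3 * δ * β ^ 2)) ≤ 6 * (L / (w * β)) := by
    rw [Real.sqrt_le_left (by positivity), hδw]
    have : 80 * L ^ 2 / (3 * w ^ 2 * β ^ 2) = 80 / 3 * (L / (w * β)) ^ 2 := by field_simp
    rw [this, mul_pow]
    gcongr
    norm_num
  have c3 : √(40 * t ^ 2 * L ^ 2 / δ) ≤ 161 * (L / (w ^ 3 * β)) := by
    have h1 : √(40 * t ^ 2 * L ^ 2 / δ) ≤ 7 * (t * L / w) := by
      rw [Real.sqrt_le_left (by positivity), hδw]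
      have : 40 * t ^ 2 * L ^ 2 / w ^ 2 = 40 * (t * L / w) ^ 2 := by field_simp
      rw [this, mul_pow]
      gcongr
      norm_num
    refine h1.trans ?_
    calc 7 * (t * L / w) ≤ 7 * (23 / (δ * β) * L / w) := by gcongr
      _ = _ := by rw [hδw]; field_simp; norm_num
  have c4 : √(32 * t * L ^ 2 / (3 * β)) ≤ 16 * (L / (w * β)) := by
    rw [Real.sqrt_le_left (by positivity)]
    calc 32 * t * L ^ 2 / (3 * β) ≤ 32 * (23 / (δ * β)) * L ^ 2 / (3 * β) := by gcongr
      _ = 736 / 3 * (L / (w * β)) ^ 2 := by rw [hδw]; field_simp; norm_num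
      _ ≤ 16 ^ 2 * (L / (w * β)) ^ 2 := by gcongr; norm_num
      _ = _ := by ring
  linarith

/-- Inserting the lower bounds for τ and B makes every term at most a multiple of β/δ; the multiples
are 5/2, 352/3 and 32/3. -/
lemma noise_coeff_le (hδ0 : 0 < δ) (hδ1 : δ ≤ 1) (hβ0 : 0 < β)
    (hτ : 64 / (3 * β * δ) ≤ (τ : ℝ)) (hB : 1 / (δ * β) ≤ (B : ℝ)) :
    160 / (3 * β * δ * τ * B) + 352 / (3 * δ ^ 2 * B) + 32 * β / (3 * δ) ≤ 131 * (β / δ) := by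
  have hτ0 : (0 : ℝ) < τ := lt_of_lt_of_le (by positivity) hτ
  have hB0 : (0 : ℝ) < B := lt_of_lt_of_le (by positivity) hB
  have h1 : 160 / (3 * β * δ * τ * B)
      ≤ 160 / (3 * β * δ * (64 / (3 * β * δ)) * (1 / (δ * β))) := by gcongr
  have e1 : 160 / (3 * β * δ * (64 / (3 * β * δ)) * (1 / (δ * β))) = 5 / 2 * (δ * β) := by
    field_simp; norm_num
  have h2 : 352 / (3 * δ ^ 2 * B) ≤ 352 / (3 * δ ^ 2 * (1 / (δ * β))) := by gcongr
  have e2 : 352 / (3 * δ ^ 2 * (1 / (δ * β))) = 352 / 3 * (β / δ) := by field_simp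
  have e3 : 32 * β / (3 * δ) = 32 / 3 * (β / δ) := by field_simp
  have h3 : δ * β ≤ β / δ := by
    rw [le_div_iff₀ hδ0]
    nlinarith [mul_pos hδ0 hβ0, mul_le_mul_of_nonneg_left hδ1 hβ0.le]
  have h4 : 0 < β / δ := by positivity
  rw [e1] at h1
  rw [e2] at h2
  linarith

/-- A period costs at most B + τ ≤ 2τ evaluations, and T / τ + 1 periods have total length at most
2T. -/
lemma gradientEvals_le (hτ0 : 0 < τ) (hτ : τ ≤ T) (hB : B ≤ τ) :
    (gradientEvals τ B T : ℝ) ≤ 4 * T := by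
  have hK : T ≤ (T / τ + 1) * τ := by
    rw [mul_comm]; exact (Nat.lt_mul_div_succ T hτ0).le
  have hK2 : (T / τ + 1) * τ ≤ 2 * T := by
    have := Nat.div_mul_le_self T τ
    rw [Nat.add_mul]; omega
  have h1 : (gradientEvals τ B T : ℝ)
      ≤ ∑ t ∈ Finset.range ((T / τ + 1) * τ), if τ ∣ t then (0 : ℝ) + B else 1 := by
    rw [gradientEvals]
    push_cast
    simp only [zero_add]
    exact Finset.sum_le_sum_of_subset_of_nonneg (Finset.range_subset_range.2 hK) fun _ _ _ => by
      split_ifs <;> positivity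
  have h2 := sum_ite_dvd_le (A := fun _ => 0) (a := (B : ℝ)) hτ0 zero_le_one (T / τ + 1)
  refine (h1.trans h2).trans ?_
  have h3 : (((T / τ + 1 : ℕ) : ℝ)) * B ≤ ((T / τ + 1 : ℕ) : ℝ) * τ := by gcongr
  have h4 : ((T / τ + 1 : ℕ) : ℝ) * τ ≤ 2 * T := by exact_mod_cast hK2
  simp only [Finset.sum_const_zero]
  linarith

/-- The rate obtained with the specific hyperparameters. -/
def rateBound (L Δ s δ : ℝ) (T : ℕ) : ℝ :=
  L * Δ / (δ ^ (5 / 2 : ℝ) * T) + √(L * Δ * s ^ 2 / (δ ^ (7 / 2 : ℝ) * T))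

/-- Let w = √δ, 1/β = 1 + u, and let v be the square root in the rate. Then LΔ/(w⁵T) · u = v and
s²/δ = uv. So the Δ-term is of order LΔ/(w⁵T) + v, and the noise term, of order βs²/δ = βuv, is at
most of order v. The coefficients 16 · 187 and 2 · 131 add up to less than 3300. -/
lemma choices_bound_le (hL : 0 < L) (hΔ : 0 < Δ) (hδ0 : 0 < δ) (hδ1 : δ ≤ 1) (hT : 0 < T)
    (hs : 0 < s) (hβ : β = betaChoice L Δ s δ T) (hτ : τ = tauChoice δ β)
    (hη : η = etaChoice L δ β τ) (hB : B = batchChoice δ β) :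
    16 * Δ / (δ * η * T) + 2 * ((160 / (3 * β * δ * τ * B) + 352 / (3 * δ ^ 2 * B)
      + 32 * β / (3 * δ)) * s ^ 2) ≤ 3300 * rateBound L Δ s δ T := by
  have hT0 : (0 : ℝ) < T := by exact_mod_cast hT
  have hβ0 : 0 < β := hβ ▸ betaChoice_pos
  have hβ1 : β ≤ 1 := hβ ▸ betaChoice_le_one
  have hη0 : 0 < η := hη ▸ etaChoice_pos hL
  have hinv : η⁻¹ ≤ 187 * (L / (√δ ^ 3 * β)) := by
    rw [hη, hτ]; exact inv_etaChoice_le hL hδ0 hδ1 hβ0 hβ1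
  have hnoise := noise_coeff_le (τ := τ) (B := B) hδ0 hδ1 hβ0 (hτ ▸ le_tauChoice)
    (by rw [hB]; exact Nat.le_ceil _)
  have r5 : δ ^ (5 / 2 : ℝ) = √δ ^ 5 := by rw [← rpow_half_odd hδ0]; norm_num
  have r7 : δ ^ (7 / 2 : ℝ) = √δ ^ 7 := by rw [← rpow_half_odd hδ0]; norm_num
  rw [betaChoice_eq hδ0] at hβ
  rw [rateBound, r5, r7]
  have hw : 0 < √δ := Real.sqrt_pos.2 hδ0
  have hδw : δ = √δ ^ 2 := (Real.sq_sqrt hδ0.le).symm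
  set w := √δ with hwdef
  set u := √(w ^ 3 * s ^ 2 * T / (L * Δ)) with hu
  set v := √(L * Δ * s ^ 2 / (w ^ 7 * T)) with hv
  have hu0 : 0 ≤ u := Real.sqrt_nonneg _
  have hv0 : 0 ≤ v := Real.sqrt_nonneg _
  have hβi : 1 / β = 1 + u := by rw [hβ, one_div, inv_inv]
  have hβu : β * u ≤ 1 := by
    rw [hβ, inv_mul_le_iff₀ (by positivity)]
    linarith
  have h1 : L * Δ / (w ^ 5 * T) * u = v := by
    have : L * Δ / (w ^ 5 * T) * u
        = √((L * Δ / (w ^ 5 * T)) ^ 2 * (w ^ 3 * s ^ 2 * T / (L * Δ))) := by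
      rw [Real.sqrt_mul (by positivity), Real.sqrt_sq (by positivity)]
    rw [this, hv]
    congr 1
    field_simp
  have h2 : s ^ 2 / δ = u * v := by
    rw [hu, hv, ← Real.sqrt_mul (by positivity)]
    have : w ^ 3 * s ^ 2 * T / (L * Δ) * (L * Δ * s ^ 2 / (w ^ 7 * T)) = (s ^ 2 / w ^ 2) ^ 2 := by
      field_simp
    rw [this, Real.sqrt_sq (by positivity), hδw]
  have c1 : 16 * Δ / (δ * η * T) ≤ 2992 * (L * Δ / (w ^ 5 * T) + v) := by
    calc 16 * Δ / (δ * η * T) = 16 * Δ / (δ * T) * η⁻¹ := by field_simp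
      _ ≤ 16 * Δ / (δ * T) * (187 * (L / (w ^ 3 * β))) := by gcongr
      _ = 2992 * (L * Δ / (w ^ 5 * T)) * (1 / β) := by rw [hδw]; field_simp; norm_num
      _ = 2992 * (L * Δ / (w ^ 5 * T) + L * Δ / (w ^ 5 * T) * u) := by rw [hβi]; ring
      _ = _ := by rw [h1]
  have c2 : (160 / (3 * β * δ * τ * B) + 352 / (3 * δ ^ 2 * B) + 32 * β / (3 * δ)) * s ^ 2
      ≤ 131 * v := by
    calc _ ≤ 131 * (β / δ) * s ^ 2 := by gcongr
      _ = 131 * (β * (s ^ 2 / δ)) := by ring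
      _ = 131 * (β * u * v) := by rw [h2]; ring
      _ ≤ 131 * (1 * v) := by gcongr
      _ = _ := by ring
  have c3 : 0 ≤ L * Δ / (w ^ 5 * T) := by positivity
  linarith

lemma rateBound_nonneg (hL : 0 < L) (hΔ : 0 < Δ) (hδ : 0 < δ) : 0 ≤ rateBound L Δ s δ T := by
  rw [rateBound]; positivity

/-- The two hypotheses on T make each summand of the rate at most ε/(2C); the second is squared
because of the root. -/
lemma rateBound_le (hδ0 : 0 < δ) (hT : 0 < T) (hε : 0 < ε) {C : ℝ}
    (hC : 0 < C) (h1 : 2 * C * (L * Δ / (δ ^ (5 / 2 : ℝ) * ε)) ≤ T)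
    (h2 : 4 * C ^ 2 * (L * Δ * s ^ 2 / (δ ^ (7 / 2 : ℝ) * ε ^ 2)) ≤ T) :
    C * rateBound L Δ s δ T ≤ ε := by
  have hT0 : (0 : ℝ) < T := by exact_mod_cast hT
  have a0 : 0 < δ ^ (5 / 2 : ℝ) := Real.rpow_pos_of_pos hδ0 _
  have b0 : 0 < δ ^ (7 / 2 : ℝ) := Real.rpow_pos_of_pos hδ0 _
  rw [rateBound]
  set a := δ ^ (5 / 2 : ℝ)
  set b := δ ^ (7 / 2 : ℝ)
  have c1 : L * Δ / (a * T) ≤ ε / (2 * C) := by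
    rw [mul_div_assoc', div_le_iff₀ (by positivity)] at h1
    rw [div_le_div_iff₀ (by positivity) (by positivity)]
    linarith
  have c2 : √(L * Δ * s ^ 2 / (b * T)) ≤ ε / (2 * C) := by
    rw [Real.sqrt_le_left (by positivity)]
    rw [mul_div_assoc', div_le_iff₀ (by positivity)] at h2
    rw [div_pow, div_le_div_iff₀ (by positivity) (by positivity)]
    linarith
  have c3 : C * (ε / (2 * C)) = ε / 2 := by field_simp
  have := mul_le_mul_of_nonneg_left (add_le_add c1 c2) hC.le
  linarith

end Choices

/-! ### Averages over shorter horizons. -/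

section Averages

variable {N : ℕ} {m n : Fin N → ℕ} {Ω : Type v} [MeasurableSpace Ω] {μ : Measure Ω}
  {f : Params m n → ℝ} {x : ℕ → Ω → Params m n} {T T' : ℕ} {c c' : ℝ}

lemma AvgSqGradLE.mono (h : AvgSqGradLE μ f x T c) (hc : c ≤ c') : AvgSqGradLE μ f x T c' :=
  ⟨h.1, h.2.trans hc⟩

lemma AvgSqGradLE.of_longer (h : AvgSqGradLE μ f x T' c) (hT : 0 < T) (hTT : T ≤ T') :
    AvgSqGradLE μ f x T (T' / T * c) := by
  refine ⟨fun t ht => h.1 t (ht.trans_le hTT), ?_⟩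
  have hT0 : (0 : ℝ) < T := by exact_mod_cast hT
  have hT0' : (0 : ℝ) < T' := by exact_mod_cast hT.trans_le hTT
  have h1 := h.2
  rw [one_div, inv_mul_le_iff₀ (by positivity)] at h1 ⊢
  have e : (T : ℝ) * (T' / T * c) = T' * c := by field_simp
  rw [e]
  exact (Finset.sum_le_sum_of_subset_of_nonneg (Finset.range_subset_range.2 hTT)
    fun _ _ _ => integral_nonneg fun _ => sq_nonneg _).trans h1

end Averages

/-! ### The rate for an arbitrary admissible T. -/

section Rates

variable {N : ℕ} {m n k : Fin N → ℕ} {Ω : Type v} [MeasurableSpace Ω] {Ξ : Type u}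
  [MeasurableSpace Ξ] {μ : Measure Ω} [IsProbabilityMeasure μ] {𝒟 : Measure Ξ}
  [IsProbabilityMeasure 𝒟] {f : Params m n → ℝ} {F : Params m n → Ξ → ℝ} {L : ℝ}
  {σ : Fin N → ℝ} {ξ : ℕ → ℕ → Ω → Ξ}
  {topk : (ℓ : Fin N) → Matrix (Fin (m ℓ)) (Fin (n ℓ)) ℝ → Matrix (Fin (m ℓ)) (Fin (n ℓ)) ℝ}
  {x₀ : Params m n}

/-- Convergence rate for the specific hyperparameters. -/
theorem avgSqGradLE_run_choices (hN : 0 < N) (hk : ∀ ℓ, 1 ≤ k ℓ ∧ k ℓ ≤ m ℓ * n ℓ)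
    (hbdd : BddBelow (Set.range f)) (hL : 0 < L) (hf : IsSmooth L f) (hσ : ∀ ℓ, 0 < σ ℓ)
    (hF : IsGradientOracle f F 𝒟 σ) (hξ : IsSampleStream μ 𝒟 ξ)
    (htop : ∀ ℓ, IsTopKRule (k ℓ) (topk ℓ)) {δ s Δ : ℝ} (hδ : δ = minDensity m n k)
    (hs : s = totalSigma σ) (hΔ : Δ = gap f x₀) (hΔ0 : 0 < Δ) {T : ℕ} {β η : ℝ} {τ B : ℕ}
    (hT : minIterations L Δ s δ ≤ T) (hβ : β = betaChoice L Δ s δ T) (hτ : τ = tauChoice δ β)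
    (hη : η = etaChoice L δ β τ) (hB : B = batchChoice δ β) :
    AvgSqGradLE μ f (iterate F topk β η τ B x₀ ξ) T (3300 * rateBound L Δ s δ T) := by
  have hδ0 : 0 < δ := hδ ▸ minDensity_pos hN hk
  have hδ1 : δ ≤ 1 := hδ ▸ minDensity_le_one hN hk
  have hs0 : 0 < s := by
    have : Nonempty (Fin N) := ⟨⟨0, hN⟩⟩
    rw [hs, totalSigma]
    exact Real.sqrt_pos.2 (Finset.sum_pos (fun ℓ _ => pow_pos (hσ ℓ) 2) Finset.univ_nonempty)
  have hT0 : (0 : ℝ) < T := lt_of_lt_of_le (by rw [minIterations]; positivity) hT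
  have hTn : 0 < T := by exact_mod_cast hT0
  have hβ0 : 0 < β := hβ ▸ betaChoice_pos
  have hβ1 : β ≤ 1 := hβ ▸ betaChoice_le_one
  have hη0 : 0 < η := hη ▸ etaChoice_pos hL
  have hτl : 64 / (3 * β * δ) ≤ (τ : ℝ) := hτ ▸ le_tauChoice
  have hτ0 : (0 : ℝ) < τ := lt_of_lt_of_le (by positivity) hτl
  have hτn : 0 < τ := by exact_mod_cast hτ0
  have hτT : τ ≤ T := by rw [hτ, hβ]; exact tauChoice_le hδ0 hL hΔ0 hT
  have hB1 : 1 ≤ B := hB ▸ one_le_batchChoice hδ0 hβ0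
  have hB0 : (0 : ℝ) < B := by positivity
  obtain ⟨e1, e2, e3⟩ := etaChoice_le (δ := δ) (β := β) (τ := τ) hL
  -- The general bound needs whole periods, so T is rounded up to Kτ with K = T / τ + 1; τ ≤ T gives
  -- Kτ ≤ 2T. Restricting back to T iterations costs Kτ/T, which cancels in the Δ-term and at most
  -- doubles the noise term.
  have hK : T ≤ (T / τ + 1) * τ := by
    rw [mul_comm]; exact (Nat.lt_mul_div_succ T hτn).le
  have hK2 : (T / τ + 1) * τ ≤ 2 * T := by
    have := Nat.div_mul_le_self T τ
    rw [Nat.add_mul]; omega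
  have main := avgSqGradLE_run (K := T / τ + 1) hN hk hbdd hL hf hF hξ htop hδ hs hΔ hβ0 hβ1 hτl
    hη0 (hη ▸ e1) (hη ▸ e2 hδ0 hβ0) (hη ▸ e3 hδ0 hτn) hB1 (Nat.le_add_left 1 _)
  refine (main.of_longer hTn hK).mono
    (le_trans ?_ (choices_bound_le hL hΔ0 hδ0 hδ1 hTn hs0 hβ hτ hη hB))
  set K : ℕ := T / τ + 1 with hKdef
  have hK0 : (0 : ℝ) < K := by positivity
  have hK2' : (K : ℝ) * τ ≤ 2 * T := by exact_mod_cast hK2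
  push_cast
  set c : ℝ := (160 / (3 * β * δ * τ * B) + 352 / (3 * δ ^ 2 * B) + 32 * β / (3 * δ)) * s ^ 2
    with hc
  have hc0 : 0 ≤ c := by positivity
  rw [mul_add]
  have t1 : (K : ℝ) * τ / T * (16 * Δ / (δ * η * K * τ)) = 16 * Δ / (δ * η * T) := by
    field_simp
  have t2 : (K : ℝ) * τ / T * c ≤ 2 * c := by
    gcongr
    rw [div_le_iff₀ hT0]
    exact hK2'
  linarith

end Rates

end

end GaSare

theorem mainTheorem7 :
    ∃ C : ℝ, 0 < C ∧
      ∀ (N : ℕ) (m n k : Fin N → ℕ), 0 < N → (∀ ℓ, 1 ≤ k ℓ ∧ k ℓ ≤ m ℓ * n ℓ) →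
      ∀ (Ω : Type v) [MeasurableSpace Ω] (μ : Measure Ω) [IsProbabilityMeasure μ]
        (Ξ : Type u) [MeasurableSpace Ξ] (𝒟 : Measure Ξ) [IsProbabilityMeasure 𝒟]
        (f : GaSare.Params m n → ℝ) (F : GaSare.Params m n → Ξ → ℝ)
        (L : ℝ) (σ : Fin N → ℝ) (ξ : ℕ → ℕ → Ω → Ξ) (x₀ : GaSare.Params m n)
        (topk : (ℓ : Fin N) →
          Matrix (Fin (m ℓ)) (Fin (n ℓ)) ℝ → Matrix (Fin (m ℓ)) (Fin (n ℓ)) ℝ),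
      BddBelow (Set.range f) → 0 < L → GaSare.IsSmooth L f →
      (∀ ℓ, 0 < σ ℓ) → GaSare.IsGradientOracle f F 𝒟 σ →
      GaSare.IsSampleStream μ 𝒟 ξ → (∀ ℓ, GaSare.IsTopKRule (k ℓ) (topk ℓ)) →
      ∀ (δ s Δ : ℝ), δ = GaSare.minDensity m n k → s = GaSare.totalSigma σ →
        Δ = GaSare.gap f x₀ →
      -- bound for general hyperparameters
      (∀ (β η : ℝ) (τ B K : ℕ), 0 < β → β ≤ 1 → 64 / (3 * β * δ) ≤ (τ : ℝ) → 0 < η →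
        η ≤ min (1 / (4 * L)) (min (√(3 * δ * β ^ 2 / (80 * L ^ 2)))
          (min (√(δ / (40 * (τ : ℝ) ^ 2 * L ^ 2))) (√(3 * β / (32 * (τ : ℝ) * L ^ 2))))) →
        1 ≤ B → 1 ≤ K →
        GaSare.AvgSqGradLE μ f (GaSare.iterate F topk β η τ B x₀ ξ) (K * τ)
          (16 * Δ / (δ * η * K * τ)
            + (160 / (3 * β * δ * τ * B) + 352 / (3 * δ ^ 2 * B) + 32 * β / (3 * δ)) * s ^ 2)) ∧
      -- rate for the specific hyperparameters
      (0 < Δ → ∀ (T : ℕ) (β η : ℝ) (τ B : ℕ), GaSare.minIterations L Δ s δ ≤ (T : ℝ) →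
        β = GaSare.betaChoice L Δ s δ T → τ = GaSare.tauChoice δ β →
        η = GaSare.etaChoice L δ β τ → B = GaSare.batchChoice δ β →
        GaSare.AvgSqGradLE μ f (GaSare.iterate F topk β η τ B x₀ ξ) T
          (C * (L * Δ / (δ ^ (5 / 2 : ℝ) * T)
            + √(L * Δ * s ^ 2 / (δ ^ (7 / 2 : ℝ) * T))))) ∧
      -- complexity of reaching accuracy `ε`
      (0 < Δ → ∀ ε : ℝ, 0 < ε → ∃ (T : ℕ) (β η : ℝ) (τ B : ℕ),
        GaSare.minIterations L Δ s δ ≤ (T : ℝ) ∧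
        β = GaSare.betaChoice L Δ s δ T ∧ τ = GaSare.tauChoice δ β ∧
        η = GaSare.etaChoice L δ β τ ∧ B = GaSare.batchChoice δ β ∧
        GaSare.AvgSqGradLE μ f (GaSare.iterate F topk β η τ B x₀ ξ) T ε ∧
        (GaSare.gradientEvals τ B T : ℝ) ≤
          C * (L * Δ * s ^ 2 / (δ ^ (7 / 2 : ℝ) * ε ^ 2) + L * Δ / (δ ^ (5 / 2 : ℝ) * ε)
            + s ^ 2 / (δ ^ (1 / 2 : ℝ) * L * Δ) + 1 / δ)) := by

  -- The constant is 16 · 3300²: the count is at most 4T, and T contains 4 · 3300² times the leading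
  -- complexity term.
  refine ⟨174240000, by norm_num, ?_⟩
  intro N m n k hN hk Ω _ μ _ Ξ _ 𝒟 _ f F L σ ξ x₀ topk hbdd hL hf hσ hF hξ htop δ s Δ hδ hs hΔ
  have hδ0 : 0 < δ := hδ ▸ GaSare.minDensity_pos hN hk
  have rate : 0 < Δ → ∀ (T : ℕ) (β η : ℝ) (τ B : ℕ), GaSare.minIterations L Δ s δ ≤ (T : ℝ) →
      β = GaSare.betaChoice L Δ s δ T → τ = GaSare.tauChoice δ β →
      η = GaSare.etaChoice L δ β τ → B = GaSare.batchChoice δ β →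
      GaSare.AvgSqGradLE μ f (GaSare.iterate F topk β η τ B x₀ ξ) T
        (3300 * GaSare.rateBound L Δ s δ T) :=
    fun hΔ0 T β η τ B hT hβ hτ hη hB =>
      GaSare.avgSqGradLE_run_choices hN hk hbdd hL hf hσ hF hξ htop hδ hs hΔ hΔ0 hT hβ hτ hη hB
  refine ⟨?_, ?_, ?_⟩
  · intro β η τ B K hβ0 hβ1 hτ hη hη' hB hK
    simp only [le_min_iff] at hη'
    exact GaSare.avgSqGradLE_run hN hk hbdd hL hf hF hξ htop hδ hs hΔ hβ0 hβ1 hτ hη hη'.1 hη'.2.1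
      hη'.2.2.1 hB hK
  · intro hΔ0 T β η τ B hT hβ hτ hη hB
    refine (rate hΔ0 T β η τ B hT hβ hτ hη hB).mono ?_
    have := GaSare.rateBound_nonneg (s := s) (T := T) hL hΔ0 hδ0
    change 3300 * _ ≤ 174240000 * GaSare.rateBound L Δ s δ T
    linarith
  · intro hΔ0 ε hε
    have a0 : 0 < δ ^ (5 / 2 : ℝ) := Real.rpow_pos_of_pos hδ0 _
    have b0 : 0 < δ ^ (7 / 2 : ℝ) := Real.rpow_pos_of_pos hδ0 _
    set p := L * Δ * s ^ 2 / (δ ^ (7 / 2 : ℝ) * ε ^ 2) with hp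
    set q := L * Δ / (δ ^ (5 / 2 : ℝ) * ε) with hq
    have hp0 : 0 ≤ p := by positivity
    have hq0 : 0 ≤ q := by positivity
    -- Adding the admissibility threshold and the two accuracy thresholds of `GaSare.rateBound_le`
    -- with constant 3300 satisfies all three at once.
    set Z := GaSare.minIterations L Δ s δ + 2 * 3300 * q + 4 * 3300 ^ 2 * p with hZ
    have hmin : 0 < GaSare.minIterations L Δ s δ := by
      rw [GaSare.minIterations]; positivity
    have hT := Nat.le_ceil Z
    have hT' := (Nat.ceil_lt_add_one (a := Z) (by positivity)).le
    set T := ⌈Z⌉₊ with hTdef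
    have hTm : GaSare.minIterations L Δ s δ ≤ (T : ℝ) := by linarith
    have hT0 : 0 < T := by
      have : (0 : ℝ) < T := hmin.trans_le hTm
      exact_mod_cast this
    refine ⟨T, _, _, _, _, hTm, rfl, rfl, rfl, rfl, ?_, ?_⟩
    · exact (rate hΔ0 T _ _ _ _ hTm rfl rfl rfl rfl).mono
        (GaSare.rateBound_le hδ0 hT0 hε (by norm_num) (by linarith) (by linarith))
    · have hβ0 : 0 < GaSare.betaChoice L Δ s δ T := GaSare.betaChoice_pos
      have hev := GaSare.gradientEvals_le (B := GaSare.batchChoice δ (GaSare.betaChoice L Δ s δ T))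
        (lt_of_lt_of_le (GaSare.one_le_batchChoice hδ0 hβ0)
          (GaSare.batchChoice_le_tauChoice hδ0 hβ0))
        (GaSare.tauChoice_le hδ0 hL hΔ0 hTm) (GaSare.batchChoice_le_tauChoice hδ0 hβ0)
      refine hev.trans ?_
      have hδ1 : 1 ≤ 1 / δ := by
        rw [le_div_iff₀ hδ0, one_mul, hδ]; exact GaSare.minDensity_le_one hN hk
      have e1 : 128 / (3 * δ) = 128 / 3 * (1 / δ) := by field_simp
      have e2 : (128 * s) ^ 2 / (9 * √δ * L * Δ)
          = 16384 / 9 * (s ^ 2 / (δ ^ (1 / 2 : ℝ) * L * Δ)) := by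
        rw [← Real.sqrt_eq_rpow]
        have : 0 < √δ := Real.sqrt_pos.2 hδ0
        field_simp
        ring
      have hr0 : 0 ≤ s ^ 2 / (δ ^ (1 / 2 : ℝ) * L * Δ) := by positivity
      rw [hZ, GaSare.minIterations, e1, e2] at hT'
      linarith
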